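/- Let $\mathscr C$ be a rigid C$^*$-tensor category with simple unit $\mathbb 1$ (i.e. $\mathrm{End}(\mathbb 1)=\mathbb C I_{\mathbb 1}\neq 0$), finite direct sums and subobjects, written as if it were strict. Let $\mathscr S\ni\mathbb 1$ be a set of representatives of the isomorphism classes of simple objects. For every $\alpha\in\mathscr S$ choose a conjugate object $\overline\alpha$ and a standard solution $\eta_\alpha\in \mathrm{Hom}(\mathbb 1,\overline\alpha\alpha)$, $\varepsilon_\alpha\in \mathrm{Hom}(\alpha\overline\alpha,\mathbb 1)$ of the conjugate equations $(\varepsilon_\alpha\otimes I_\alpha)(I_\alpha\otimes\eta_\alpha)=I_\alpha$, $(I_{\overline\alpha}\otimes\varepsilon_\alpha)(\eta_\alpha\otimes I_{\overline\alpha})=I_{\overline\alpha}$ (as $\alpha$ is simple, standard means $\eta_\alpha^*\eta_\alpha=\varepsilon_\alpha\varepsilon_\alpha^*$), and put $d_\alpha=\eta_\alpha^*\eta_\alpha\in\mathbb R$. Let $\Lambda=\mathscr S\sqcup\overline{\mathscr S}$ be the disjoint union of $\mathscr S$ and of the set of letters $\overline\alpha$, $\alpha\in\mathscr S$, with the involution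 $\alpha\leftrightarrow\overline\alpha$, and put $r_\alpha=\eta_\alpha$, $r_{\overline\alpha}=\varepsilon_\alpha^*$ for $\alpha\in\mathscr S$. Let $\lambda_\alpha>0$ ($\alpha\in\mathscr S$) be arbitrary and $\lambda_{\overline\alpha}=1/\lambda_\alpha$. Let $\mathfrak A(\mathbb 1)=\bigoplus_{\beta\in\mathscr S}\mathbb C I_\beta$ be the von Neumann algebra of bounded families $(a_\beta)_{\beta\in\mathscr S}$, with the weight $\tau(a)=\sum_\beta d_\beta a_\beta$, $a\ge 0$. Let $H(\mathbb 1)=\bigoplus_{\beta_1,\beta_2\in\mathscr S,\ \alpha\in\Lambda}\mathrm{Hom}(\beta_1,\beta_2\alpha)$ (algebraic direct sum), with $a\cdot\xi\cdot b=a_{\beta_2}b_{\beta_1}\xi$ for $\xi\in \mathrm{Hom}(\beta_1,\beta_2\alpha)$, and with the $\mathfrak A(\mathbb 1)$-valued inner product for which the summands are mutually orthogonal and $\langle\xi,\zeta\rangle_{\mathfrak A(\mathbb 1)}=\xi^*\zeta\in \mathrm{End}(\beta_1)=\mathbb C I_{\beta_1}$ for $\xi,\zeta\in \mathrm{Hom}(\beta_1,\beta_2\alpha)$.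 For $\xi\in \mathrm{Hom}(\beta_1,\beta_2\alpha)$ let $\overline\xi=(\xi^*\otimes I_{\overline\alpha})(I_{\beta_2}\otimes r_{\overline\alpha})\in \mathrm{Hom}(\beta_2,\beta_1\overline\alpha)$, and let $$S\xi=\sqrt{\lambda_\alpha}\,\overline\xi,\qquad U(z)\xi=\lambda_\alpha^{iz}\,\xi\quad(z\in\mathbb C),$$ where $S$ is extended additively and $U(z)$ linearly to $H(\mathbb 1)$. Then, with this $S$ and $U$, $H(\mathbb 1)$ is a Tomita $\mathfrak A(\mathbb 1)$-$\mathfrak A(\mathbb 1)$ bimodule. That is, writing $\mathfrak A=\mathfrak A(\mathbb 1)$ and $H=H(\mathbb 1)$: $\mathfrak A$ is a von Neumann algebra and $\tau$ is a normal semifinite faithful tracial weight on it; $H$ is a pre-Hilbert $\mathfrak A$-$\mathfrak A$ bimodule, i.e. $\langle\cdot,\cdot\rangle_{\mathfrak A}$ is sesquilinear and positive definite, $\langle\xi,b\cdot\zeta\cdot a\rangle_{\mathfrak A}=\langle b^*\cdot\xi,\zeta\rangle_{\mathfrak A}\,a$, and $\|a\cdot\xi\|_H\le\|a\|\,\|\xi\|_H$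 with $\|\xi\|_H=\|\langle\xi,\xi\rangle_{\mathfrak A}\|^{1/2}$; the left action is normal, i.e. each map $a\mapsto\langle\xi,a\cdot\xi\rangle_{\mathfrak A}$ is weak-operator continuous on the unit ball of $\mathfrak A$; and, with $\langle\xi,\zeta\rangle=\tau(\langle\xi,\zeta\rangle_{\mathfrak A})$, 1. $\tau(\langle\xi,\xi\rangle_{\mathfrak A})<\infty$ for all $\xi\in H$; 2. $S$ is conjugate linear, $S(a\cdot\xi\cdot b)=b^*\cdot S(\xi)\cdot a^*$ and $S^2=\mathrm{id}$; 3. $\{U(z)\}_{z\in\mathbb C}$ is a one-parameter group ($U(0)=\mathrm{id}$, $U(z+w)=U(z)U(w)$) of bimodule isomorphisms of $H$ such that for all $\xi,\zeta\in H$ and $z\in\mathbb C$: (a) $z\mapsto U(z)\zeta$ is continuous for $\|\cdot\|_H$ and $z\mapsto\langle\xi,U(z)\zeta\rangle$ is entire; (b) $S(U(z)\xi)=U(\overline z)S(\xi)$; (c) $\langle\xi,U(z)\zeta\rangle=\langle U(-\overline z)\xi,\zeta\rangle$; (d) $\langle S\xi,S\zeta\rangle=\langle\zeta,U(-i)\xi\rangle$.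 -/

import Mathlib

open CategoryTheory MonoidalCategory
open scoped ENNReal NNReal ComplexOrder DirectSum

universe v u w

noncomputable section

/-! ### Traces on von Neumann algebras, pre-Hilbert bimodules, Tomita bimodules -/

namespace TomitaBimodule

section Algebra

variable {A : Type u} [CStarAlgebra A] [PartialOrder A] [StarOrderedRing A]

/-- `D` is an increasing net of positive elements with supremum `a`. -/
def IncreasesTo (D : Set A) (a : A) : Prop :=
  D.Nonempty ∧ DirectedOn (· ≤ ·) D ∧ (∀ d ∈ D, 0 ≤ d) ∧ IsLUB D a

/-- A normal semifinite faithful tracial weight, given as a function into `[0, ∞]`;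
only its values on the positive cone of `A` matter. -/
structure IsNSFTrace (τ : A → ℝ≥0∞) : Prop where
  map_add : ∀ a b : A, 0 ≤ a → 0 ≤ b → τ (a + b) = τ a + τ b
  map_smul : ∀ (r : ℝ≥0) (a : A), 0 ≤ a → τ (((r : ℝ) : ℂ) • a) = r * τ a
  tracial : ∀ a : A, τ (star a * a) = τ (a * star a)
  faithful : ∀ a : A, 0 ≤ a → τ a = 0 → a = 0
  normal : ∀ (D : Set A) (a : A), IncreasesTo D a → τ a = ⨆ d ∈ D, τ d
  semifinite : ∀ a : A, 0 ≤ a → a ≠ 0 → ∃ b : A, 0 ≤ b ∧ b ≤ a ∧ b ≠ 0 ∧ τ b < ∞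

/-- `a = p - q + i (r - s)` with `p, q, r, s` positive and of finite weight. -/
def IsFiniteDecomposition (τ : A → ℝ≥0∞) (a : A) (x : A × A × A × A) : Prop :=
  (0 ≤ x.1 ∧ 0 ≤ x.2.1 ∧ 0 ≤ x.2.2.1 ∧ 0 ≤ x.2.2.2) ∧
  (τ x.1 < ∞ ∧ τ x.2.1 < ∞ ∧ τ x.2.2.1 < ∞ ∧ τ x.2.2.2 < ∞) ∧
  a = (x.1 - x.2.1) + Complex.I • (x.2.2.1 - x.2.2.2)

open Classical in
/-- The linear extension of a weight to the linear span of the positive elements of finite weight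
(and `0` outside of that span). It does not depend on the decomposition that is used:
see `extend_eq`. -/
def extend (τ : A → ℝ≥0∞) (a : A) : ℂ :=
  if h : ∃ x : A × A × A × A, IsFiniteDecomposition τ a x then
    (((τ h.choose.1).toReal - (τ h.choose.2.1).toReal : ℝ) : ℂ) +
      Complex.I * (((τ h.choose.2.2.1).toReal - (τ h.choose.2.2.2).toReal : ℝ) : ℂ)
  else 0

theorem extend_eq {τ : A → ℝ≥0∞} (hτ : IsNSFTrace τ) {a : A} {x : A × A × A × A}
    (hx : IsFiniteDecomposition τ a x) :
    extend τ a = (((τ x.1).toReal - (τ x.2.1).toReal : ℝ) : ℂ) +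
      Complex.I * (((τ x.2.2.1).toReal - (τ x.2.2.2).toReal : ℝ) : ℂ) := by
  have key : ∀ p q p' q' : A, 0 ≤ p → 0 ≤ q → 0 ≤ p' → 0 ≤ q' → τ p < ∞ → τ q < ∞ → τ p' < ∞ →
      τ q' < ∞ → p - q = p' - q' → (τ p).toReal - (τ q).toReal = (τ p').toReal - (τ q').toReal := by
    intro p q p' q' hp hq hp' hq' fp fq fp' fq' h
    have h1 : p + q' = p' + q := by
      rw [sub_eq_sub_iff_add_eq_add] at h
      exact h
    have h2 := congrArg τ h1
    rw [hτ.map_add _ _ hp hq', hτ.map_add _ _ hp' hq] at h2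
    have h3 := congrArg ENNReal.toReal h2
    rw [ENNReal.toReal_add fp.ne fq'.ne, ENNReal.toReal_add fp'.ne fq.ne] at h3
    linarith
  have h : ∃ x : A × A × A × A, IsFiniteDecomposition τ a x := ⟨x, hx⟩
  obtain ⟨⟨a1, a2, a3, a4⟩, ⟨b1, b2, b3, b4⟩, c⟩ := hx
  obtain ⟨⟨a1', a2', a3', a4'⟩, ⟨b1', b2', b3', b4'⟩, c'⟩ := h.choose_spec
  have sa : ∀ p q : A, 0 ≤ p → 0 ≤ q → star (p - q) = p - q := fun p q hp hq => by
    rw [star_sub, (IsSelfAdjoint.of_nonneg hp).star_eq, (IsSelfAdjoint.of_nonneg hq).star_eq]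
  have e := c.symm.trans c'
  have e' := congrArg star e
  simp only [star_add, star_smul, sa _ _ a1 a2, sa _ _ a3 a4, sa _ _ a1' a2', sa _ _ a3' a4',
    Complex.star_def, Complex.conj_I, neg_smul] at e'
  have r1 : x.1 - x.2.1 = h.choose.1 - h.choose.2.1 := by
    have : (2 : ℂ) • (x.1 - x.2.1) = (2 : ℂ) • (h.choose.1 - h.choose.2.1) := by
      rw [two_smul, two_smul]
      have := congrArg₂ (· + ·) e e'
      convert this using 1 <;> abel
    exact smul_right_injective A (two_ne_zero : (2 : ℂ) ≠ 0) this
  have r2 : x.2.2.1 - x.2.2.2 = h.choose.2.2.1 - h.choose.2.2.2 := by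
    rw [r1] at e
    exact smul_right_injective A Complex.I_ne_zero (add_left_cancel e)
  rw [extend, dif_pos h, key _ _ _ _ a1 a2 a1' a2' b1 b2 b1' b2' r1,
    key _ _ _ _ a3 a4 a3' a4' b3 b4 b3' b4' r2]

/-- A normal positive linear functional. -/
def IsNormalFunctional (φ : A →ₗ[ℂ] ℂ) : Prop :=
  (∀ a : A, 0 ≤ a → 0 ≤ φ a) ∧
  ∀ (D : Set A) (a : A), IncreasesTo D a → IsLUB ((fun d => (φ d).re) '' D) (φ a).re

variable (A) in
/-- The ultraweak topology of a von Neumann algebra, i.e. the one generated by the normal positive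
functionals. On bounded sets it is the weak-operator topology of any faithful normal
representation. -/
abbrev ultraweak : TopologicalSpace A :=
  ⨅ φ : {φ : A →ₗ[ℂ] ℂ // IsNormalFunctional φ}, TopologicalSpace.induced φ.1 inferInstance

end Algebra

section Bimodule

variable {A : Type u} [CStarAlgebra A] [PartialOrder A] [StarOrderedRing A]
variable {H : Type w} [AddCommGroup H] [Module ℂ H] [Module A H] [Module Aᵐᵒᵖ H]

/-- The norm `‖ξ‖_H = ‖⟨ξ, ξ⟩_A‖ ^ (1/2)`. -/
def moduleNorm (ip : H → H → A) (ξ : H) : ℝ := Real.sqrt ‖ip ξ ξ‖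

/-- A pre-Hilbert `A`-`A` bimodule. The left action is `a • ξ`, the right action `ξ · a` is
`MulOpposite.op a • ξ`, and `ip` is the `A`-valued inner product. -/
structure IsPreHilbertBimodule (ip : H → H → A) : Prop where
  left_scalar : ∀ (c : ℂ) (ξ : H), (algebraMap ℂ A c) • ξ = c • ξ
  right_scalar : ∀ (c : ℂ) (ξ : H), MulOpposite.op (algebraMap ℂ A c) • ξ = c • ξ
  left_right : ∀ (a b : A) (ξ : H), a • (MulOpposite.op b • ξ) = MulOpposite.op b • (a • ξ)
  add_left : ∀ ξ₁ ξ₂ ζ : H, ip (ξ₁ + ξ₂) ζ = ip ξ₁ ζ + ip ξ₂ ζ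
  add_right : ∀ ξ ζ₁ ζ₂ : H, ip ξ (ζ₁ + ζ₂) = ip ξ ζ₁ + ip ξ ζ₂
  smul_left : ∀ (c : ℂ) (ξ ζ : H), ip (c • ξ) ζ = star c • ip ξ ζ
  smul_right : ∀ (c : ℂ) (ξ ζ : H), ip ξ (c • ζ) = c • ip ξ ζ
  ip_action : ∀ (a b : A) (ξ ζ : H),
    ip ξ (b • (MulOpposite.op a • ζ)) = ip (star b • ξ) ζ * a
  ip_nonneg : ∀ ξ : H, 0 ≤ ip ξ ξ
  ip_definite : ∀ ξ : H, ip ξ ξ = 0 → ξ = 0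
  norm_left_action : ∀ (a : A) (ξ : H), moduleNorm ip (a • ξ) ≤ ‖a‖ * moduleNorm ip ξ

/-- The left action is normal: every map `a ↦ ⟨ξ, a · ξ⟩_A` is weak-operator continuous on the
unit ball. -/
def HasNormalLeftAction (ip : H → H → A) : Prop :=
  ∀ ξ : H, @ContinuousOn A A (ultraweak A) (ultraweak A) (fun a => ip ξ (a • ξ))
    (Metric.closedBall 0 1)

/-- The scalar inner product `⟨ξ, ζ⟩ = τ (⟨ξ, ζ⟩_A)`. -/
def scalarInner (τ : A → ℝ≥0∞) (ip : H → H → A) (ξ ζ : H) : ℂ := extend τ (ip ξ ζ)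

/-- `H`, with `A`-valued inner product `ip`, involution `S` and complex one-parameter group `U`, is
a Tomita `A`-`A` bimodule, where `A` is a semifinite von Neumann algebra and `τ` is a normal
semifinite faithful tracial weight on it. -/
structure IsTomitaBimodule (τ : A → ℝ≥0∞) (ip : H → H → A) (S : H → H) (U : ℂ → H → H) : Prop where
  vonNeumann : WStarAlgebra A
  trace : IsNSFTrace τ
  preHilbert : IsPreHilbertBimodule ip
  normal : HasNormalLeftAction ip
  finite : ∀ ξ : H, τ (ip ξ ξ) < ∞
  S_add : ∀ ξ ζ : H, S (ξ + ζ) = S ξ + S ζ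
  S_smul : ∀ (c : ℂ) (ξ : H), S (c • ξ) = star c • S ξ
  S_action : ∀ (a b : A) (ξ : H),
    S (a • (MulOpposite.op b • ξ)) = star b • (MulOpposite.op (star a) • S ξ)
  S_S : ∀ ξ : H, S (S ξ) = ξ
  U_add : ∀ (z : ℂ) (ξ ζ : H), U z (ξ + ζ) = U z ξ + U z ζ
  U_smul : ∀ (z c : ℂ) (ξ : H), U z (c • ξ) = c • U z ξ
  U_action : ∀ (z : ℂ) (a b : A) (ξ : H),
    U z (a • (MulOpposite.op b • ξ)) = a • (MulOpposite.op b • U z ξ)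
  U_bijective : ∀ z : ℂ, Function.Bijective (U z)
  U_zero : ∀ ξ : H, U 0 ξ = ξ
  U_group : ∀ (z w : ℂ) (ξ : H), U (z + w) ξ = U z (U w ξ)
  U_continuous : ∀ (ζ : H) (z₀ : ℂ),
    Filter.Tendsto (fun z => moduleNorm ip (U z ζ - U z₀ ζ)) (nhds z₀) (nhds 0)
  U_entire : ∀ ξ ζ : H, Differentiable ℂ (fun z => scalarInner τ ip ξ (U z ζ))
  S_U : ∀ (z : ℂ) (ξ : H), S (U z ξ) = U (star z) (S ξ)
  U_adjoint : ∀ (z : ℂ) (ξ ζ : H),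
    scalarInner τ ip ξ (U z ζ) = scalarInner τ ip (U (-star z) ξ) ζ
  S_inner : ∀ ξ ζ : H,
    scalarInner τ ip (S ξ) (S ζ) = scalarInner τ ip ζ (U (-Complex.I) ξ)

end Bimodule

end TomitaBimodule

/-! ### Rigid C⋆-tensor categories -/

/-- A C⋆-category: a `ℂ`-linear category with an antilinear involution `dag` that reverses arrows
and with complete norms on the spaces of arrows satisfying the C⋆-identity and such that `f* f` is
a positive element of the C⋆-algebra `End X` for every arrow `f` out of `X`. -/
class CStarCategory (C : Type u) [Category.{v} C] [Preadditive C] [Linear ℂ C] where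
  dag : ∀ {X Y : C}, (X ⟶ Y) → (Y ⟶ X)
  dag_dag : ∀ {X Y : C} (f : X ⟶ Y), dag (dag f) = f
  dag_comp : ∀ {X Y Z : C} (f : X ⟶ Y) (g : Y ⟶ Z), dag (f ≫ g) = dag g ≫ dag f
  dag_add : ∀ {X Y : C} (f g : X ⟶ Y), dag (f + g) = dag f + dag g
  dag_smul : ∀ {X Y : C} (c : ℂ) (f : X ⟶ Y), dag (c • f) = star c • dag f
  homNorm : ∀ X Y : C, Norm (X ⟶ Y)
  norm_core : ∀ X Y : C, NormedSpace.Core ℂ (X ⟶ Y)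
  norm_complete : ∀ {X Y : C} (x : ℕ → (X ⟶ Y)),
    (∀ ε > (0 : ℝ), ∃ N, ∀ m ≥ N, ∀ n ≥ N, ‖x m - x n‖ < ε) →
      ∃ f : X ⟶ Y, ∀ ε > (0 : ℝ), ∃ N, ∀ n ≥ N, ‖x n - f‖ < ε
  norm_comp_le : ∀ {X Y Z : C} (f : X ⟶ Y) (g : Y ⟶ Z), ‖f ≫ g‖ ≤ ‖f‖ * ‖g‖
  norm_comp_dag : ∀ {X Y : C} (f : X ⟶ Y), ‖f ≫ dag f‖ = ‖f‖ ^ 2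
  comp_dag_pos : ∀ {X Y : C} (f : X ⟶ Y), ∃ g : X ⟶ X, f ≫ dag f = g ≫ dag g

open CStarCategory (dag)

/-- A (not necessarily strict) rigid C⋆-tensor category with finite direct sums and subobjects.
`v ≫ dag v = 𝟙` says that `v` is an isometry. -/
class RigidCStarTensorCategory (C : Type u) [Category.{v} C] [Preadditive C] [Linear ℂ C]
    [MonoidalCategory C] [MonoidalPreadditive C] [MonoidalLinear ℂ C] extends CStarCategory C where
  dag_tensor : ∀ {X₁ Y₁ X₂ Y₂ : C} (f : X₁ ⟶ Y₁) (g : X₂ ⟶ Y₂), dag (f ⊗ₘ g) = dag f ⊗ₘ dag g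
  dag_associator : ∀ X Y Z : C, dag (α_ X Y Z).hom = (α_ X Y Z).inv
  dag_leftUnitor : ∀ X : C, dag (λ_ X).hom = (λ_ X).inv
  dag_rightUnitor : ∀ X : C, dag (ρ_ X).hom = (ρ_ X).inv
  directSum : ∀ X Y : C, ∃ (Z : C) (i : X ⟶ Z) (j : Y ⟶ Z),
    i ≫ dag i = 𝟙 X ∧ j ≫ dag j = 𝟙 Y ∧ dag i ≫ i + dag j ≫ j = 𝟙 Z
  subobject : ∀ {X : C} (p : X ⟶ X), p ≠ 0 → p ≫ p = p → dag p = p →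
    ∃ (Y : C) (i : Y ⟶ X), i ≫ dag i = 𝟙 Y ∧ dag i ≫ i = p
  conjugates : ∀ X : C, ∃ Xbar : C, Nonempty (ExactPairing Xbar X)

namespace TomitaFromCategory

section Simple

variable {C : Type u} [Category.{v} C] [Preadditive C] [Linear ℂ C]

/-- Simple (irreducible) objects: `End X = ℂ 1_X ≠ 0`. -/
def IsSimpleObj (X : C) : Prop := 𝟙 X ≠ 0 ∧ ∀ f : X ⟶ X, ∃ c : ℂ, f = c • 𝟙 X

open Classical in
/-- The scalar `c` with `f = c 1_X`, for an endomorphism `f` of a simple object `X`. -/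
def coeff {X : C} (f : X ⟶ X) : ℂ := if h : ∃ c : ℂ, f = c • 𝟙 X then h.choose else 0

end Simple

variable {C : Type u} [Category.{v} C] [Preadditive C] [Linear ℂ C]
  [MonoidalCategory C] [MonoidalPreadditive C] [MonoidalLinear ℂ C]

variable (C) in
/-- A representative set of the simple objects, containing the tensor unit. -/
structure Representatives where
  carrier : Set C
  unit_mem : 𝟙_ C ∈ carrier
  simple : ∀ X ∈ carrier, IsSimpleObj X
  existsUnique : ∀ X : C, IsSimpleObj X → ∃! Y : C, Y ∈ carrier ∧ Nonempty (X ≅ Y)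

/-- The index type of the representative set. -/
abbrev Representatives.Idx (R : Representatives C) : Type u := {X : C // X ∈ R.carrier}

variable [RigidCStarTensorCategory C]

/-- A choice, for every representative simple object `a`, of a conjugate object and of a standard
solution `η : 𝟙 ⟶ ā ⊗ a`, `ε : a ⊗ ā ⟶ 𝟙` of the conjugate equations. Since `a` is simple, a
solution is standard if and only if it is normalized, i.e. `η* η = ε ε*`. -/
structure StandardConjugates (R : Representatives C) where
  conj : R.Idx → C
  pairing : ∀ a : R.Idx, ExactPairing (conj a) a.1
  normalized : ∀ a : R.Idx,
    (pairing a).coevaluation' ≫ dag (pairing a).coevaluation' =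
      dag (pairing a).evaluation' ≫ (pairing a).evaluation'

variable {R : Representatives C}

namespace StandardConjugates

variable (D : StandardConjugates R)

/-- `η_a : 𝟙 ⟶ ā ⊗ a`. -/
def eta (a : R.Idx) : 𝟙_ C ⟶ D.conj a ⊗ a.1 := (D.pairing a).coevaluation'

/-- `ε_a : a ⊗ ā ⟶ 𝟙`. -/
def eps (a : R.Idx) : a.1 ⊗ D.conj a ⟶ 𝟙_ C := (D.pairing a).evaluation'

/-- The dimension `d_a = η_a* η_a`. -/
def dim (a : R.Idx) : ℝ := (coeff (D.eta a ≫ dag (D.eta a))).re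

end StandardConjugates

/-- The set of letters: the disjoint union of the representatives (`Sum.inl a` is the letter `a`)
and of their conjugates (`Sum.inr a` is the letter `ā`). -/
abbrev Letter (R : Representatives C) : Type u := R.Idx ⊕ R.Idx

/-- The involution `α ↦ ᾱ` of the set of letters. -/
abbrev Letter.bar (l : Letter R) : Letter R := Sum.swap l

/-- The scalars `λ_α`, for all letters `α`, from their values on the representatives:
`λ_ā = 1 / λ_a`. -/
def letterScalar (lam : R.Idx → ℝ) : Letter R → ℝ
  | Sum.inl a => lam a
  | Sum.inr a => 1 / lam a

namespace StandardConjugates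

variable (D : StandardConjugates R)

/-- The object of the category underlying a letter. -/
def obj : Letter R → C
  | Sum.inl a => a.1
  | Sum.inr a => D.conj a

/-- The arrow `r_ᾱ : 𝟙 ⟶ α ⊗ ᾱ`, that is `ε_a*` if `α = a` and `η_a` if `α = ā`. -/
def rBar : ∀ l : Letter R, 𝟙_ C ⟶ D.obj l ⊗ D.obj (Letter.bar l)
  | Sum.inl a => dag (D.eps a)
  | Sum.inr a => D.eta a

end StandardConjugates

/-- The von Neumann algebra `𝔄(𝟙) = ⊕_β ℂ`, the bounded families of complex numbers. -/
abbrev Alg (R : Representatives C) : Type u := lp (fun _ : R.Idx => ℂ) ∞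

instance : PartialOrder (Alg R) := CStarAlgebra.spectralOrder _

instance : StarOrderedRing (Alg R) := CStarAlgebra.spectralOrderedRing _

/-- The trace on `𝔄(𝟙)` with `τ(1_β) = d_β`. -/
def StandardConjugates.tau (D : StandardConjugates R) (a : Alg R) : ℝ≥0∞ :=
  ∑' β : R.Idx, ENNReal.ofReal (D.dim β * (a β).re)

/-- Triples `(β₁, β₂, α)`. -/
abbrev Triple (R : Representatives C) : Type u := R.Idx × R.Idx × Letter R

/-- `(β₁, β₂, α) ↦ (β₂, β₁, ᾱ)`. -/
abbrev Triple.bar (t : Triple R) : Triple R := (t.2.1, t.1, Letter.bar t.2.2)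

namespace StandardConjugates

variable (D : StandardConjugates R)

/-- The space `Hom(β₁, β₂ α)`. -/
def HomSpace (t : Triple R) : Type v := t.1.1 ⟶ t.2.1.1 ⊗ D.obj t.2.2

/-- An element of `Hom(β₁, β₂ α)` as an arrow. -/
def toHom {t : Triple R} (ξ : D.HomSpace t) : t.1.1 ⟶ t.2.1.1 ⊗ D.obj t.2.2 := ξ

instance (t : Triple R) : AddCommGroup (D.HomSpace t) :=
  inferInstanceAs (AddCommGroup (t.1.1 ⟶ t.2.1.1 ⊗ D.obj t.2.2))

instance (t : Triple R) : Module ℂ (D.HomSpace t) :=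
  inferInstanceAs (Module ℂ (t.1.1 ⟶ t.2.1.1 ⊗ D.obj t.2.2))

/-- The left action: `a · ξ = a(β₂) ξ` on `Hom(β₁, β₂ α)`. -/
instance (t : Triple R) : Module (Alg R) (D.HomSpace t) where
  smul a ξ := a t.2.1 • ξ
  one_smul ξ := one_smul ℂ ξ
  mul_smul a b ξ := mul_smul (a t.2.1) (b t.2.1) ξ
  smul_zero a := smul_zero (a t.2.1)
  smul_add a := smul_add (a t.2.1)
  add_smul a b := add_smul (a t.2.1) (b t.2.1)
  zero_smul := zero_smul ℂ

/-- The right action: `ξ · a = a(β₁) ξ` on `Hom(β₁, β₂ α)`. -/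
instance (t : Triple R) : Module (Alg R)ᵐᵒᵖ (D.HomSpace t) where
  smul a ξ := a.unop t.1 • ξ
  one_smul ξ := one_smul ℂ ξ
  mul_smul a b ξ := (congrArg (· • ξ) (mul_comm (b.unop t.1) (a.unop t.1))).trans
    (mul_smul (a.unop t.1) (b.unop t.1) ξ)
  smul_zero a := smul_zero (a.unop t.1)
  smul_add a := smul_add (a.unop t.1)
  add_smul a b := add_smul (a.unop t.1) (b.unop t.1)
  zero_smul := zero_smul ℂ

/-- The bimodule `H(𝟙)`, the algebraic direct sum of the spaces `Hom(β₁, β₂ α)`. -/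
abbrev Hbim : Type (max u v) := ⨁ t : Triple R, D.HomSpace t

open Classical in
/-- The `𝔄(𝟙)`-valued inner product: the spaces `Hom(β₁, β₂ α)` are mutually orthogonal, and
`⟨ξ, ζ⟩ = ξ* ζ ∈ End β₁ = ℂ` for `ξ, ζ ∈ Hom(β₁, β₂ α)`. -/
def ip (ξ ζ : D.Hbim) : Alg R :=
  ∑ t ∈ DFinsupp.support ξ,
    lp.single ∞ t.1 (coeff (D.toHom (ζ t) ≫ dag (D.toHom (ξ t))))

/-- The conjugation `ξ ↦ ξ̄ = (ξ* ⊗ 1_ᾱ) ∘ (1_β₂ ⊗ r_ᾱ)` from `Hom(β₁, β₂ α)` to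
`Hom(β₂, β₁ ᾱ)`, with the coherence isomorphisms written out. -/
def homConj (t : Triple R) (ξ : t.1.1 ⟶ t.2.1.1 ⊗ D.obj t.2.2) :
    t.2.1.1 ⟶ t.1.1 ⊗ D.obj (Letter.bar t.2.2) :=
  (ρ_ t.2.1.1).inv ≫ t.2.1.1 ◁ D.rBar t.2.2 ≫
    (α_ t.2.1.1 (D.obj t.2.2) (D.obj (Letter.bar t.2.2))).inv ≫
      dag ξ ▷ D.obj (Letter.bar t.2.2)

/-- The conjugation `ξ ↦ ξ̄` as an additive map. -/
def homConjHom (t : Triple R) : D.HomSpace t →+ D.HomSpace (Triple.bar t) :=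
  AddMonoidHom.mk' (D.homConj t) (fun ξ ζ => by
    simp only [homConj]
    erw [CStarCategory.dag_add, MonoidalPreadditive.add_whiskerRight, Preadditive.comp_add,
      Preadditive.comp_add, Preadditive.comp_add]
    rfl)

open Classical in
/-- The involution: `S ξ = √λ_α ξ̄` for `ξ ∈ Hom(β₁, β₂ α)`. -/
def invol (lam : R.Idx → ℝ) : D.Hbim →+ D.Hbim :=
  DirectSum.toAddMonoid fun t =>
    (DirectSum.of D.HomSpace (Triple.bar t)).comp
      ((DistribSMul.toAddMonoidHom _ ((Real.sqrt (letterScalar lam t.2.2) : ℝ) : ℂ)).comp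
        (D.homConjHom t))

/-- The one-parameter group: `U(z) ξ = λ_α ^ (i z) ξ` for `ξ ∈ Hom(β₁, β₂ α)`. -/
def oneParam (lam : R.Idx → ℝ) (z : ℂ) : D.Hbim →ₗ[ℂ] D.Hbim :=
  DirectSum.lmap fun t =>
    ((letterScalar lam t.2.2 : ℂ) ^ (Complex.I * z)) • LinearMap.id

end StandardConjugates

end TomitaFromCategory

end

/-!
By Frobenius reciprocity `f ↦ (f* ⊗ 1) (1 ⊗ ε*)` has the conjugation of the adjoint pairing as its
inverse; this gives `S² = 1`. The modular relation for `S` amounts to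
`tr (ḡ f̄*) = tr (f g*)`, which follows by turning the left hand side into a trace over `c ⊗ X`,
provided that the left and right traces of the chosen pairings agree and that the left trace is
cyclic between different objects. Standardness gives the former, first for simple objects and then
for tensor products. Cyclicity holds up to the twist of an arrow, and the twist is trivial: the
defect `v = g - twist g` satisfies `tr (v* v) = -tr (v v*)`, where both traces are positive and
faithful. On the summand `Hom(β₁, β₂ α)` everything else is multiplication by a scalar, and
`𝔄(𝟙)` is `ℓ^∞` with a strictly positive weight.
-/

noncomputable section

open CStarCategory

/-! ### The involution of a C⋆-tensor category -/

namespace CStarCategory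

variable {C : Type u} [Category.{v} C] [Preadditive C] [Linear ℂ C] [CStarCategory C]

attribute [simp] dag_dag dag_comp dag_add dag_smul

@[simp]
theorem dag_id (X : C) : dag (𝟙 X) = 𝟙 X := by
  simpa using (dag_comp (dag (𝟙 X)) (𝟙 X)).symm

theorem eq_zero_of_comp_dag_eq_zero {X Y : C} {f : X ⟶ Y} (h : f ≫ dag f = 0) : f = 0 := by
  let := homNorm X Y
  let := homNorm X X
  have hnorm := norm_comp_dag f
  rw [h, ((norm_core X X).norm_eq_zero_iff 0).2 rfl] at hnorm
  exact ((norm_core X Y).norm_eq_zero_iff f).1 (pow_eq_zero_iff two_ne_zero |>.1 hnorm.symm)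

end CStarCategory

namespace RigidCStarTensorCategory

variable {C : Type u} [Category.{v} C] [Preadditive C] [Linear ℂ C]
  [MonoidalCategory C] [MonoidalPreadditive C] [MonoidalLinear ℂ C] [RigidCStarTensorCategory C]

attribute [simp] dag_associator dag_leftUnitor dag_rightUnitor

@[simp]
theorem dag_whiskerLeft (X : C) {Y Z : C} (f : Y ⟶ Z) : dag (X ◁ f) = X ◁ dag f := by
  rw [← id_tensorHom, dag_tensor, dag_id, id_tensorHom]

@[simp]
theorem dag_whiskerRight {X Y : C} (f : X ⟶ Y) (Z : C) : dag (f ▷ Z) = dag f ▷ Z := by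
  rw [← tensorHom_id, dag_tensor, dag_id, tensorHom_id]

@[simp]
theorem dag_associator_inv (X Y Z : C) : dag (α_ X Y Z).inv = (α_ X Y Z).hom := by
  rw [← dag_associator, dag_dag]

@[simp]
theorem dag_leftUnitor_inv (X : C) : dag (λ_ X).inv = (λ_ X).hom := by
  rw [← dag_leftUnitor, dag_dag]

@[simp]
theorem dag_rightUnitor_inv (X : C) : dag (ρ_ X).inv = (ρ_ X).hom := by
  rw [← dag_rightUnitor, dag_dag]

end RigidCStarTensorCategory

namespace TomitaFromCategory

open ExactPairing RigidCStarTensorCategory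

section Simple

variable {C : Type u} [Category.{v} C] [Preadditive C] [Linear ℂ C]

theorem Representatives.isSimpleObj_unit [MonoidalCategory C] (R : Representatives C) :
    IsSimpleObj (𝟙_ C) := R.simple _ R.unit_mem

namespace IsSimpleObj

variable {X : C} (hX : IsSimpleObj X)

include hX

theorem eq_coeff_smul (f : X ⟶ X) : f = coeff f • 𝟙 X := by
  have h := hX.2 f
  rw [coeff, dif_pos h]
  exact h.choose_spec

theorem coeff_smul_id (c : ℂ) : coeff (c • 𝟙 X) = c :=
  (smul_left_injective ℂ hX.1 (hX.eq_coeff_smul (c • 𝟙 X))).symm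

theorem coeff_eq {f : X ⟶ X} {c : ℂ} (h : f = c • 𝟙 X) : coeff f = c := by
  rw [h, hX.coeff_smul_id]

theorem coeff_add (f g : X ⟶ X) : coeff (f + g) = coeff f + coeff g :=
  hX.coeff_eq (by rw [add_smul, ← hX.eq_coeff_smul, ← hX.eq_coeff_smul])

theorem coeff_smul (c : ℂ) (f : X ⟶ X) : coeff (c • f) = c * coeff f :=
  hX.coeff_eq (by rw [mul_smul, ← hX.eq_coeff_smul])

variable [CStarCategory C] {Y : C}

theorem coeff_comp_dag_nonneg (f : X ⟶ Y) : 0 ≤ coeff (f ≫ dag f) := by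
  obtain ⟨g, hg⟩ := comp_dag_pos f
  have hgg : g ≫ dag g = (coeff g * star (coeff g)) • 𝟙 X := by
    rw [hX.eq_coeff_smul g, dag_smul, dag_id, Linear.smul_comp, Category.id_comp, smul_smul,
      hX.coeff_smul_id]
  rw [hg, hX.coeff_eq hgg]
  exact mul_star_self_nonneg _

theorem eq_zero_of_coeff_comp_dag_eq_zero {f : X ⟶ Y} (h : coeff (f ≫ dag f) = 0) : f = 0 :=
  eq_zero_of_comp_dag_eq_zero (by rw [hX.eq_coeff_smul (f ≫ dag f), h, zero_smul])

end IsSimpleObj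

end Simple

/-! ### Mates -/

section Mates

variable {C : Type u} [Category.{v} C] [MonoidalCategory C] {X X' Y Y' Z Z' : C}

/-- The mate `Y' ⟶ X'` of an arrow `f : X ⟶ Y`. The pairings are explicit arguments, because the
same object is used with several of them. -/
def mate (P : ExactPairing X' X) (Q : ExactPairing Y' Y) (f : X ⟶ Y) : Y' ⟶ X' :=
  @leftAdjointMate C _ _ X Y (.mk X' (exact := P)) (.mk Y' (exact := Q)) f

/-- The arrow `X ⟶ Y` whose mate is `k : Y' ⟶ X'`. -/
def unmate (P : ExactPairing X' X) (Q : ExactPairing Y' Y) (k : Y' ⟶ X') : X ⟶ Y :=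
  @rightAdjointMate C _ _ Y' X' (.mk Y (exact := Q)) (.mk X (exact := P)) k

variable (P : ExactPairing X' X) (Q : ExactPairing Y' Y) (S : ExactPairing Z' Z)

theorem coevaluation_comp_mate (f : X ⟶ Y) : η_ Y' Y ≫ mate P Q f ▷ Y = η_ X' X ≫ X' ◁ f :=
  @coevaluation_comp_leftAdjointMate C _ _ X Y ⟨X'⟩ ⟨Y'⟩ f

theorem coevaluation_comp_mate_assoc (f : X ⟶ Y) (h : X' ⊗ Y ⟶ Z) :
    η_ Y' Y ≫ mate P Q f ▷ Y ≫ h = η_ X' X ≫ X' ◁ f ≫ h := by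
  rw [← Category.assoc, coevaluation_comp_mate, Category.assoc]

theorem mate_comp_evaluation (f : X ⟶ Y) : X ◁ mate P Q f ≫ ε_ X' X = f ▷ Y' ≫ ε_ Y' Y :=
  @leftAdjointMate_comp_evaluation C _ _ X Y ⟨X'⟩ ⟨Y'⟩ f

theorem coevaluation_comp_whiskerLeft_injective :
    Function.Injective fun f : X ⟶ Z => η_ X' X ≫ X' ◁ f := fun f g h =>
  (cancel_epi (ρ_ X).hom).1 (by
    simpa only [tensorLeftHomEquiv_symm_coevaluation_comp_whiskerLeft]
      using congrArg (tensorLeftHomEquiv _ X' X Z).symm h)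

theorem coevaluation_comp_whiskerRight_injective :
    Function.Injective fun f : X' ⟶ Z => η_ X' X ≫ f ▷ X := fun f g h =>
  (cancel_epi (λ_ X').hom).1 (by
    simpa only [tensorRightHomEquiv_symm_coevaluation_comp_whiskerRight]
      using congrArg (tensorRightHomEquiv _ X' X Z).symm h)

@[simp]
theorem mate_unmate (k : Y' ⟶ X') : mate P Q (unmate P Q k) = k :=
  coevaluation_comp_whiskerRight_injective Q ((coevaluation_comp_mate P Q _).trans
    (@coevaluation_comp_rightAdjointMate C _ _ Y' X' ⟨Y⟩ ⟨X⟩ k))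

theorem mate_comp (f : X ⟶ Y) (g : Y ⟶ Z) : mate P S (f ≫ g) = mate Q S g ≫ mate P Q f :=
  @comp_leftAdjointMate C _ _ X Y Z ⟨X'⟩ ⟨Y'⟩ ⟨Z'⟩ f g

theorem tensor_coevaluation_eq :
    η_ (Y' ⊗ X') (X ⊗ Y) = η_ Y' Y ≫ Y' ◁ (λ_ Y).inv ≫ Y' ◁ (η_ X' X ▷ Y) ≫
      Y' ◁ (α_ X' X Y).hom ≫ (α_ Y' X' (X ⊗ Y)).inv := by
  rw [tensor_coevaluation]
  monoidal

theorem tensor_evaluation_eq :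
    ε_ (Y' ⊗ X') (X ⊗ Y) = (α_ (X ⊗ Y) Y' X').inv ≫ (α_ X Y Y').hom ▷ X' ≫
      (X ◁ ε_ Y' Y) ▷ X' ≫ (ρ_ X).hom ▷ X' ≫ ε_ X' X := by
  rw [tensor_evaluation]
  monoidal

end Mates

/-! ### Traces and spherical pairings -/

section Traces

variable {C : Type u} [Category.{v} C] [Preadditive C] [Linear ℂ C]
  [MonoidalCategory C] [MonoidalPreadditive C] [MonoidalLinear ℂ C] [RigidCStarTensorCategory C]
  {X X' Y Y' : C}

/-- The adjoint of an exact pairing, with coevaluation `ε*` and evaluation `η*`. -/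
@[reducible]
def adjointPairing (P : ExactPairing X' X) : ExactPairing X X' where
  coevaluation' := dag (ε_ X' X)
  evaluation' := dag (η_ X' X)
  coevaluation_evaluation' := by
    simpa only [dag_comp, dag_whiskerLeft, dag_whiskerRight, dag_associator, dag_leftUnitor,
      dag_rightUnitor_inv, Category.assoc] using congrArg dag (evaluation_coevaluation X' X)
  evaluation_coevaluation' := by
    simpa only [dag_comp, dag_whiskerLeft, dag_whiskerRight, dag_associator_inv,
      dag_leftUnitor_inv, dag_rightUnitor, Category.assoc]
      using congrArg dag (coevaluation_evaluation X' X)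

theorem adjointPairing_adjointPairing (P : ExactPairing X' X) :
    adjointPairing (adjointPairing P) = P := by
  obtain ⟨η, ε, _, _⟩ := P
  unfold adjointPairing
  congr 1
  exacts [dag_dag η, dag_dag ε]

/-- The trace `η* (1 ⊗ T) η` of an endomorphism `T`. -/
def leftTrace (_P : ExactPairing X' X) (T : X ⟶ X) : 𝟙_ C ⟶ 𝟙_ C :=
  η_ X' X ≫ X' ◁ T ≫ dag (η_ X' X)

/-- The trace `ε (T ⊗ 1) ε*` of an endomorphism `T`. -/
def rightTrace (_P : ExactPairing X' X) (T : X ⟶ X) : 𝟙_ C ⟶ 𝟙_ C :=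
  dag (ε_ X' X) ≫ T ▷ X' ≫ ε_ X' X

/-- The partial trace of an endomorphism of `X ⊗ Y` over the left factor. -/
def leftPartialTrace (_P : ExactPairing X' X) (T : X ⊗ Y ⟶ X ⊗ Y) : Y ⟶ Y :=
  (λ_ Y).inv ≫ η_ X' X ▷ Y ≫ (α_ X' X Y).hom ≫ X' ◁ T ≫ (α_ X' X Y).inv ≫
    dag (η_ X' X) ▷ Y ≫ (λ_ Y).hom

/-- The partial trace of an endomorphism of `X ⊗ Y` over the right factor. -/
def rightPartialTrace (_Q : ExactPairing Y' Y) (T : X ⊗ Y ⟶ X ⊗ Y) : X ⟶ X :=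
  (ρ_ X).inv ≫ X ◁ dag (ε_ Y' Y) ≫ (α_ X Y Y').inv ≫ T ▷ Y' ≫ (α_ X Y Y').hom ≫
    X ◁ ε_ Y' Y ≫ (ρ_ X).hom

/-- An exact pairing is spherical if its left and right traces coincide. For a simple object this
means that the pairing is normalized, i.e. that it is a standard solution of the conjugate
equations. -/
def IsSpherical (P : ExactPairing X' X) : Prop :=
  ∀ T : X ⟶ X, leftTrace P T = rightTrace P T

section Single

variable (P : ExactPairing X' X)

theorem leftTrace_sub (S T : X ⟶ X) : leftTrace P (S - T) = leftTrace P S - leftTrace P T := by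
  have hwhisker : X' ◁ (S - T) = X' ◁ S - X' ◁ T := (tensorLeft X').map_sub
  simp [leftTrace, hwhisker]

theorem leftTrace_smul_id (c : ℂ) :
    leftTrace P (c • 𝟙 X) = c • (η_ X' X ≫ dag (η_ X' X)) := by
  simp [leftTrace, MonoidalLinear.whiskerLeft_smul]

theorem rightTrace_smul_id (c : ℂ) :
    rightTrace P (c • 𝟙 X) = c • (dag (ε_ X' X) ≫ ε_ X' X) := by
  simp [rightTrace, MonoidalLinear.smul_whiskerRight]

theorem leftTrace_comp_dag (v : X ⟶ Y) :
    leftTrace P (v ≫ dag v) = (η_ X' X ≫ X' ◁ v) ≫ dag (η_ X' X ≫ X' ◁ v) := by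
  simp [leftTrace]

theorem leftTrace_adjointPairing_mate (T : X ⟶ X) :
    leftTrace (adjointPairing P) (mate P P T) = rightTrace P T := by
  rw [rightTrace, ← mate_comp_evaluation P P]
  exact congrArg (dag (ε_ X' X) ≫ X ◁ mate P P T ≫ ·) (dag_dag _)

theorem rightTrace_adjointPairing_mate (T : X ⟶ X) :
    rightTrace (adjointPairing P) (mate P P T) = leftTrace P T := by
  rw [leftTrace, ← coevaluation_comp_mate_assoc P P]
  exact congrArg (· ≫ mate P P T ▷ X ≫ dag (η_ X' X)) (dag_dag _)

variable {P}

theorem IsSimpleObj.coeff_leftTrace_comp_dag_nonneg (h : IsSimpleObj (𝟙_ C)) (v : X ⟶ Y) :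
    0 ≤ coeff (leftTrace P (v ≫ dag v)) :=
  leftTrace_comp_dag P v ▸ h.coeff_comp_dag_nonneg _

theorem IsSimpleObj.eq_zero_of_coeff_leftTrace_comp_dag (h : IsSimpleObj (𝟙_ C)) {v : X ⟶ Y}
    (hv : coeff (leftTrace P (v ≫ dag v)) = 0) : v = 0 := by
  rw [leftTrace_comp_dag] at hv
  refine coevaluation_comp_whiskerLeft_injective P ?_
  simpa using h.eq_zero_of_coeff_comp_dag_eq_zero hv

theorem IsSimpleObj.isSpherical (hX : IsSimpleObj X)
    (h : η_ X' X ≫ dag (η_ X' X) = dag (ε_ X' X) ≫ ε_ X' X) : IsSpherical P := fun T => by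
  rw [hX.eq_coeff_smul T, leftTrace_smul_id, rightTrace_smul_id, h]

theorem IsSpherical.adjointPairing (hP : IsSpherical P) :
    IsSpherical (adjointPairing P) := fun T => by
  rw [← mate_unmate P P T, leftTrace_adjointPairing_mate, rightTrace_adjointPairing_mate, hP]

end Single

variable (P : ExactPairing X' X) (Q : ExactPairing Y' Y)

theorem leftTrace_tensor (T : X ⊗ Y ⟶ X ⊗ Y) :
    leftTrace (ExactPairing.tensor : ExactPairing (Y' ⊗ X') (X ⊗ Y)) T =
      leftTrace Q (leftPartialTrace P T) := by
  simp only [leftTrace, leftPartialTrace, tensor_coevaluation_eq, dag_comp, dag_whiskerLeft,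
    dag_whiskerRight, dag_associator, dag_associator_inv, dag_leftUnitor_inv]
  monoidal

theorem rightTrace_tensor (T : X ⊗ Y ⟶ X ⊗ Y) :
    rightTrace (ExactPairing.tensor : ExactPairing (Y' ⊗ X') (X ⊗ Y)) T =
      rightTrace P (rightPartialTrace Q T) := by
  simp only [rightTrace, rightPartialTrace, tensor_evaluation_eq, dag_comp, dag_whiskerLeft,
    dag_whiskerRight, dag_associator, dag_associator_inv, dag_rightUnitor]
  monoidal

theorem rightTrace_leftPartialTrace (T : X ⊗ Y ⟶ X ⊗ Y) :
    rightTrace Q (leftPartialTrace P T) = leftTrace P (rightPartialTrace Q T) := by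
  calc
    _ = 𝟙 _ ⊗≫ (𝟙_ C ◁ dag (ε_ Y' Y) ≫ η_ X' X ▷ (Y ⊗ Y')) ⊗≫ X' ◁ T ▷ Y' ⊗≫
        (dag (η_ X' X) ▷ (Y ⊗ Y') ≫ 𝟙_ C ◁ ε_ Y' Y) ⊗≫ 𝟙 _ := by
      simp only [rightTrace, leftPartialTrace]
      monoidal
    _ = 𝟙 _ ⊗≫ (η_ X' X ▷ 𝟙_ C ≫ (X' ⊗ X) ◁ dag (ε_ Y' Y)) ⊗≫ X' ◁ T ▷ Y' ⊗≫
        ((X' ⊗ X) ◁ ε_ Y' Y ≫ dag (η_ X' X) ▷ 𝟙_ C) ⊗≫ 𝟙 _ := by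
      rw [whisker_exchange, whisker_exchange]
    _ = _ := by
      simp only [leftTrace, rightPartialTrace]
      monoidal

variable {P Q}

theorem IsSpherical.tensor (hP : IsSpherical P) (hQ : IsSpherical Q) :
    IsSpherical (ExactPairing.tensor : ExactPairing (Y' ⊗ X') (X ⊗ Y)) := fun T => by
  rw [leftTrace_tensor P Q, hQ, rightTrace_leftPartialTrace, hP, rightTrace_tensor P Q]

variable (P Q)

/-- The twist of `g : X ⟶ Y`: the arrow with mate `(mate g*)*`. It measures to what extent the
involution fails to commute with mates. -/
def twist (g : X ⟶ Y) : X ⟶ Y := unmate P Q (dag (mate Q P (dag g)))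

theorem mate_twist (g : X ⟶ Y) : mate P Q (twist P Q g) = dag (mate Q P (dag g)) :=
  mate_unmate P Q _

theorem whiskerLeft_comp_dag_coevaluation (g : X ⟶ Y) :
    Y' ◁ g ≫ dag (η_ Y' Y) = mate P Q (twist P Q g) ▷ X ≫ dag (η_ X' X) := by
  simpa [mate_twist] using congrArg dag (coevaluation_comp_mate Q P (dag g)).symm

theorem dag_evaluation_comp_whiskerRight (g : X ⟶ Y) :
    dag (ε_ X' X) ≫ g ▷ X' = dag (ε_ Y' Y) ≫ Y ◁ mate P Q (twist P Q g) := by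
  simpa [mate_twist] using congrArg dag (mate_comp_evaluation Q P (dag g)).symm

theorem leftTrace_comp_eq_leftTrace_twist_comp (f : Y ⟶ X) (g : X ⟶ Y) :
    leftTrace Q (f ≫ g) = leftTrace P (twist P Q g ≫ f) := by
  rw [leftTrace, leftTrace, whiskerLeft_comp_assoc, whiskerLeft_comp_dag_coevaluation P Q,
    ← coevaluation_comp_mate_assoc Q P, ← coevaluation_comp_mate_assoc P P, mate_comp P Q P,
    comp_whiskerRight_assoc]

theorem rightTrace_comp_twist (f : Y ⟶ X) (g : X ⟶ Y) :
    rightTrace Q (f ≫ twist P Q g) = rightTrace P (g ≫ f) := by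
  have hcomp : mate Q P (twist Q P f) ≫ mate P Q (twist P Q g) =
      mate P P (twist P P (g ≫ f)) := by
    simp only [mate_twist, ← dag_comp, ← mate_comp]
  calc rightTrace Q (f ≫ twist P Q g)
      = (dag (ε_ Y' Y) ≫ f ▷ Y') ≫ twist P Q g ▷ Y' ≫ ε_ Y' Y := by simp [rightTrace]
    _ = (dag (ε_ X' X) ≫ X ◁ mate Q P (twist Q P f)) ≫ X ◁ mate P Q (twist P Q g) ≫ ε_ X' X := by
      rw [dag_evaluation_comp_whiskerRight Q P, mate_comp_evaluation P Q]
    _ = (dag (ε_ X' X) ≫ X ◁ mate P P (twist P P (g ≫ f))) ≫ ε_ X' X := by simp [← hcomp]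
    _ = rightTrace P (g ≫ f) := by
      rw [← dag_evaluation_comp_whiskerRight P P, rightTrace, Category.assoc]

variable {P Q}

namespace IsSpherical

theorem leftTrace_twist_twist_comp (hP : IsSpherical P) (hQ : IsSpherical Q) (f : Y ⟶ X)
    (g : X ⟶ Y) : leftTrace P (twist P Q (twist P Q g) ≫ f) = leftTrace P (g ≫ f) := by
  rw [← leftTrace_comp_eq_leftTrace_twist_comp, hQ, rightTrace_comp_twist, hP]

theorem twist_eq (hunit : IsSimpleObj (𝟙_ C)) (hP : IsSpherical P) (hQ : IsSpherical Q)
    (g : X ⟶ Y) : twist P Q g = g := by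
  set v := g - twist P Q g
  have hneg : leftTrace Q (dag v ≫ v) = -leftTrace P (v ≫ dag v) :=
    calc leftTrace Q (dag v ≫ v)
        = leftTrace Q (dag v ≫ g) - leftTrace Q (dag v ≫ twist P Q g) := by
          rw [← leftTrace_sub, ← Preadditive.comp_sub]
      _ = leftTrace P (twist P Q g ≫ dag v) - leftTrace P (g ≫ dag v) := by
          rw [leftTrace_comp_eq_leftTrace_twist_comp P Q _ g,
            leftTrace_comp_eq_leftTrace_twist_comp P Q _ (twist P Q g),
            leftTrace_twist_twist_comp hP hQ]
      _ = -leftTrace P (v ≫ dag v) := by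
          rw [← neg_sub, ← leftTrace_sub, ← Preadditive.sub_comp]
  have hcoeff : coeff (leftTrace Q (dag v ≫ v)) = -coeff (leftTrace P (v ≫ dag v)) := by
    rw [hneg, ← neg_one_smul ℂ, hunit.coeff_smul, neg_one_mul]
  have hQ_nonneg : 0 ≤ coeff (leftTrace Q (dag v ≫ v)) := by
    simpa using hunit.coeff_leftTrace_comp_dag_nonneg (P := Q) (dag v)
  have hv : v = 0 := hunit.eq_zero_of_coeff_leftTrace_comp_dag (P := P)
    (le_antisymm (neg_nonneg.1 (hcoeff ▸ hQ_nonneg)) (hunit.coeff_leftTrace_comp_dag_nonneg v))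
  exact (sub_eq_zero.1 hv).symm

theorem leftTrace_comp_comm (hunit : IsSimpleObj (𝟙_ C)) (hP : IsSpherical P)
    (hQ : IsSpherical Q) (f : Y ⟶ X) (g : X ⟶ Y) :
    leftTrace Q (f ≫ g) = leftTrace P (g ≫ f) := by
  rw [leftTrace_comp_eq_leftTrace_twist_comp P Q, twist_eq hunit hP hQ]

end IsSpherical

section Frobenius

variable {b b' c c' : C}

/-- The Frobenius conjugate `(f* ⊗ 1) (1 ⊗ ε*)` of an arrow `f : b ⟶ c ⊗ X`. -/
def frobeniusConj (_P : ExactPairing X' X) (f : b ⟶ c ⊗ X) : c ⟶ b ⊗ X' :=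
  (ρ_ c).inv ≫ c ◁ dag (ε_ X' X) ≫ (α_ c X X').inv ≫ dag f ▷ X'

theorem frobeniusConj_adjointPairing_frobeniusConj (P : ExactPairing X' X) (f : b ⟶ c ⊗ X) :
    frobeniusConj (adjointPairing P) (frobeniusConj P f) = f := by
  have hdag : dag (frobeniusConj P f) = (tensorRightHomEquiv b X' X c).symm f := by
    simp [frobeniusConj, tensorRightHomEquiv]
  have hadj : ∀ g : c ⟶ b ⊗ X', frobeniusConj (adjointPairing P) g =
      tensorRightHomEquiv b X' X c (dag g) := fun g =>
    congrArg ((ρ_ b).inv ≫ b ◁ · ≫ (α_ b X' X).inv ≫ dag g ▷ X) (dag_dag _)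
  rw [hadj, hdag, Equiv.apply_symm_apply]

theorem frobeniusConj_frobeniusConj_adjointPairing (P : ExactPairing X' X) (f : b ⟶ c ⊗ X') :
    frobeniusConj P (frobeniusConj (adjointPairing P) f) = f := by
  simpa only [adjointPairing_adjointPairing] using
    frobeniusConj_adjointPairing_frobeniusConj (adjointPairing P) f

theorem frobeniusConj_comp_dag_frobeniusConj (P : ExactPairing X' X) (f g : b ⟶ c ⊗ X) :
    frobeniusConj P g ≫ dag (frobeniusConj P f) = rightPartialTrace P (dag g ≫ f) := by
  simp [frobeniusConj, rightPartialTrace]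

theorem IsSpherical.leftTrace_frobeniusConj {B : ExactPairing b' b} {P : ExactPairing c' c}
    {Q : ExactPairing X' X} (hunit : IsSimpleObj (𝟙_ C)) (hB : IsSpherical B)
    (hP : IsSpherical P) (hQ : IsSpherical Q) (f g : b ⟶ c ⊗ X) :
    leftTrace P (frobeniusConj Q g ≫ dag (frobeniusConj Q f)) = leftTrace B (f ≫ dag g) :=
  calc leftTrace P (frobeniusConj Q g ≫ dag (frobeniusConj Q f))
      = rightTrace P (rightPartialTrace Q (dag g ≫ f)) := by
        rw [frobeniusConj_comp_dag_frobeniusConj, hP]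
    _ = leftTrace (ExactPairing.tensor : ExactPairing (X' ⊗ c') (c ⊗ X)) (dag g ≫ f) := by
        rw [← rightTrace_tensor P Q, hP.tensor hQ]
    _ = leftTrace B (f ≫ dag g) := leftTrace_comp_comm hunit hB (hP.tensor hQ) (dag g) f

end Frobenius

end Traces

end TomitaFromCategory

namespace TomitaFromCategory

open CStarCategory ExactPairing RigidCStarTensorCategory

namespace StandardConjugates

variable {C : Type u} [Category.{v} C] [Preadditive C] [Linear ℂ C]
  [MonoidalCategory C] [MonoidalPreadditive C] [MonoidalLinear ℂ C] [RigidCStarTensorCategory C]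
  {R : Representatives C} (D : StandardConjugates R)

theorem isSpherical_pairing (a : R.Idx) : IsSpherical (D.pairing a) :=
  (R.simple _ a.2).isSpherical (D.normalized a)

/-- The exact pairing of the objects of a letter and of its conjugate. -/
@[reducible]
def letterPairing : ∀ l : Letter R, ExactPairing (D.obj (Letter.bar l)) (D.obj l)
  | Sum.inl a => D.pairing a
  | Sum.inr a => adjointPairing (D.pairing a)

theorem isSpherical_letterPairing : ∀ l : Letter R, IsSpherical (D.letterPairing l)
  | Sum.inl a => D.isSpherical_pairing a
  | Sum.inr a => (D.isSpherical_pairing a).adjointPairing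

theorem dag_evaluation_letterPairing :
    ∀ l : Letter R, dag (D.letterPairing l).evaluation' = D.rBar l
  | Sum.inl _ => rfl
  | Sum.inr _ => dag_dag _

theorem homConj_eq_frobeniusConj (t : Triple R) (ξ : t.1.1 ⟶ t.2.1.1 ⊗ D.obj t.2.2) :
    D.homConj t ξ = frobeniusConj (D.letterPairing t.2.2) ξ := by
  rw [homConj, ← dag_evaluation_letterPairing]
  rfl

open Classical in
theorem of_homConjHom_homConjHom (t : Triple R) (ξ : D.HomSpace t) :
    DirectSum.of D.HomSpace (Triple.bar (Triple.bar t))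
      (D.homConjHom (Triple.bar t) (D.homConjHom t ξ)) = DirectSum.of D.HomSpace t ξ := by
  obtain ⟨b₁, b₂, a | a⟩ := t
  · exact congrArg (DirectSum.of D.HomSpace (b₁, b₂, Sum.inl a))
      (((D.homConj_eq_frobeniusConj (b₂, b₁, Sum.inr a) _).trans
        (congrArg _ (D.homConj_eq_frobeniusConj (b₁, b₂, Sum.inl a) ξ))).trans
          (frobeniusConj_adjointPairing_frobeniusConj (D.pairing a) _))
  · exact congrArg (DirectSum.of D.HomSpace (b₁, b₂, Sum.inr a))
      (((D.homConj_eq_frobeniusConj (b₂, b₁, Sum.inl a) _).trans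
        (congrArg _ (D.homConj_eq_frobeniusConj (b₁, b₂, Sum.inr a) ξ))).trans
          (frobeniusConj_frobeniusConj_adjointPairing (D.pairing a) _))

theorem coeff_eta_comp_dag (a : R.Idx) : coeff (D.eta a ≫ dag (D.eta a)) = D.dim a :=
  Complex.eq_re_of_ofReal_le (r := 0) (by
    rw [Complex.ofReal_zero]
    exact R.isSimpleObj_unit.coeff_comp_dag_nonneg (D.eta a))

theorem coeff_leftTrace_pairing (a : R.Idx) (T : a.1 ⟶ a.1) :
    coeff (leftTrace (D.pairing a) T) = D.dim a * coeff T := by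
  rw [(R.simple _ a.2).eq_coeff_smul T, leftTrace_smul_id, R.isSimpleObj_unit.coeff_smul,
    (R.simple _ a.2).coeff_smul_id, mul_comm]
  exact congrArg (· * _) (D.coeff_eta_comp_dag a)

theorem dim_pos (a : R.Idx) : 0 < D.dim a := by
  have hnonneg := R.isSimpleObj_unit.coeff_comp_dag_nonneg (D.eta a)
  refine (Complex.nonneg_iff.1 hnonneg).1.lt_of_ne' fun hdim => (R.simple _ a.2).1 ?_
  refine R.isSimpleObj_unit.eq_zero_of_coeff_leftTrace_comp_dag (P := D.pairing a) ?_
  have hdim' : D.dim a = 0 := hdim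
  rw [coeff_leftTrace_pairing, hdim', Complex.ofReal_zero, zero_mul]

theorem dim_mul_coeff_homConj (t : Triple R) (ξ ζ : t.1.1 ⟶ t.2.1.1 ⊗ D.obj t.2.2) :
    D.dim t.2.1 * coeff (D.homConj t ζ ≫ dag (D.homConj t ξ)) =
      D.dim t.1 * coeff (ξ ≫ dag ζ) := by
  rw [homConj_eq_frobeniusConj, homConj_eq_frobeniusConj, ← coeff_leftTrace_pairing,
    ← coeff_leftTrace_pairing, IsSpherical.leftTrace_frobeniusConj R.isSimpleObj_unit
      (D.isSpherical_pairing _) (D.isSpherical_pairing _) (D.isSpherical_letterPairing _)]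

end StandardConjugates

end TomitaFromCategory

/-! ### Bounded families of complex numbers -/

namespace TomitaBimodule

section LpInfty

variable {ι : Type u}

/-- The pairing `(a, x) ↦ ∑ i, a i * x i` of `ℓ^∞` and `ℓ¹`. -/
def lpInftyPairing (ι : Type u) :
    lp (fun _ : ι => ℂ) ∞ →L[ℂ] StrongDual ℂ (lp (fun _ : ι => ℂ) 1) :=
  lp.dualPairing ∞ 1 (fun _ => ContinuousLinearMap.mul ℂ ℂ) (K := 1)
    fun _ => ContinuousLinearMap.opNorm_mul_le ℂ ℂ

theorem lpInftyPairing_apply (a : lp (fun _ : ι => ℂ) ∞) (x : lp (fun _ : ι => ℂ) 1) :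
    lpInftyPairing ι a x = ∑' i, a i * x i := rfl

open Classical in
theorem lpInftyPairing_single (a : lp (fun _ : ι => ℂ) ∞) (i : ι) (c : ℂ) :
    lpInftyPairing ι a (lp.single 1 i c) = a i * c := by
  rw [lpInftyPairing_apply, tsum_eq_single i fun j hj => ?_, lp.single_apply_self]
  rw [lp.single_apply_ne _ _ _ hj, mul_zero]

open Classical in
theorem norm_apply_single_one_le (φ : StrongDual ℂ (lp (fun _ : ι => ℂ) 1)) (i : ι) :
    ‖φ (lp.single 1 i 1)‖ ≤ ‖φ‖ := by
  simpa only [lp.norm_single one_pos, norm_one, mul_one] using φ.le_opNorm (lp.single 1 i 1)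

theorem norm_lpInftyPairing (a : lp (fun _ : ι => ℂ) ∞) : ‖lpInftyPairing ι a‖ = ‖a‖ := by
  classical
  refine le_antisymm ?_ (lp.norm_le_of_forall_le (norm_nonneg _) fun i => ?_)
  · have hle : ‖lpInftyPairing ι‖ ≤ 1 := lp.norm_dualPairing _ _
    exact ((lpInftyPairing ι).le_of_opNorm_le hle a).trans_eq (one_mul _)
  · have h := norm_apply_single_one_le (lpInftyPairing ι a) i
    rwa [lpInftyPairing_single, mul_one] at h

theorem lpInftyPairing_surjective (ι : Type u) : Function.Surjective (lpInftyPairing ι) := by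
  classical
  intro φ
  let a : lp (fun _ : ι => ℂ) ∞ := ⟨fun i => φ (lp.single 1 i 1), memℓp_infty ⟨‖φ‖, by
    rintro _ ⟨i, rfl⟩
    exact norm_apply_single_one_le φ i⟩⟩
  refine ⟨a, lp.ext_continuousLinearMap ENNReal.one_ne_top fun i => ?_⟩
  ext
  exact (lpInftyPairing_single a i 1).trans (mul_one _)

/-- The dual of `ℓ¹`, identified with `ℓ^∞`. -/
def lpInftyEquivDual (ι : Type u) :
    lp (fun _ : ι => ℂ) ∞ ≃ₗᵢ[ℂ] StrongDual ℂ (lp (fun _ : ι => ℂ) 1) :=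
  .ofSurjective ⟨(lpInftyPairing ι).toLinearMap, norm_lpInftyPairing⟩ (lpInftyPairing_surjective ι)

instance (ι : Type u) : WStarAlgebra (lp (fun _ : ι => ℂ) ∞) where
  exists_predual := ⟨lp (fun _ : ι => ℂ) 1, inferInstance, inferInstance, inferInstance,
    ⟨(lpInftyEquivDual ι).symm.trans (starₗᵢ ℂ)⟩⟩

theorem memℓp_infty_sqrt_re (a : lp (fun _ : ι => ℂ) ∞) :
    Memℓp (fun i => ((Real.sqrt (a i).re : ℝ) : ℂ)) ∞ := by
  refine memℓp_infty ⟨Real.sqrt ‖a‖, ?_⟩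
  rintro _ ⟨i, rfl⟩
  dsimp only
  rw [Complex.norm_of_nonneg (Real.sqrt_nonneg _)]
  exact Real.sqrt_le_sqrt ((Complex.re_le_norm _).trans
    (lp.norm_apply_le_norm ENNReal.top_ne_zero a i))

/-- The weight `a ↦ ∑ i, d i * a i` on the positive elements of `ℓ^∞`; the imaginary parts, which
vanish there, are ignored. -/
def weightedSum (d : ι → ℝ) (a : lp (fun _ : ι => ℂ) ∞) : ℝ≥0∞ :=
  ∑' i, ENNReal.ofReal (d i * (a i).re)

theorem weightedSum_eq_sum (d : ι → ℝ) {s : Finset ι} {a : lp (fun _ : ι => ℂ) ∞}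
    (ha : ∀ i ∉ s, a i = 0) :
    weightedSum d a = ∑ i ∈ s, ENNReal.ofReal (d i * (a i).re) :=
  tsum_eq_sum fun i hi => by rw [ha i hi, Complex.zero_re, mul_zero, ENNReal.ofReal_zero]

theorem weightedSum_lt_top (d : ι → ℝ) {s : Finset ι} {a : lp (fun _ : ι => ℂ) ∞}
    (ha : ∀ i ∉ s, a i = 0) : weightedSum d a < ∞ := by
  rw [weightedSum_eq_sum d ha]
  exact ENNReal.sum_lt_top.2 fun _ _ => ENNReal.ofReal_lt_top

theorem weightedSum_smul (d : ι → ℝ) (r : ℝ≥0) (a : lp (fun _ : ι => ℂ) ∞) :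
    weightedSum d (((r : ℝ) : ℂ) • a) = r * weightedSum d a := by
  rw [weightedSum, weightedSum, ← ENNReal.tsum_mul_left]
  refine tsum_congr fun i => ?_
  rw [lp.coeFn_smul, Pi.smul_apply, smul_eq_mul, Complex.re_ofReal_mul, mul_left_comm,
    ENNReal.ofReal_mul r.coe_nonneg, ENNReal.ofReal_coe_nnreal]

open Classical in
/-- The element of `ℓ^∞` that agrees with the real family `f` on `s` and vanishes elsewhere. -/
def finitePart (s : Finset ι) (f : ι → ℝ) : lp (fun _ : ι => ℂ) ∞ :=
  ∑ i ∈ s, lp.single ∞ i (f i : ℂ)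

open Classical in
theorem finitePart_apply (s : Finset ι) (f : ι → ℝ) (i : ι) :
    finitePart s f i = if i ∈ s then (f i : ℂ) else 0 := by
  rw [finitePart, lp.coeFn_sum, Finset.sum_apply]
  simp_rw [lp.single_apply, Pi.single_apply]
  exact Finset.sum_ite_eq s i _

theorem finitePart_sub (s : Finset ι) (f g : ι → ℝ) :
    finitePart s (f - g) = finitePart s f - finitePart s g := by
  simp only [finitePart, Pi.sub_apply, Complex.ofReal_sub, lp.single_sub, Finset.sum_sub_distrib]

theorem finitePart_apply_eq_zero (f : ι → ℝ) {s : Finset ι} {i : ι} (hi : i ∉ s) :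
    finitePart s f i = 0 := by
  classical
  rw [finitePart_apply, if_neg hi]

theorem toReal_weightedSum_finitePart {d : ι → ℝ} (hd : ∀ i, 0 ≤ d i) (s : Finset ι) {f : ι → ℝ}
    (hf : 0 ≤ f) : (weightedSum d (finitePart s f)).toReal = ∑ i ∈ s, d i * f i := by
  classical
  rw [weightedSum_eq_sum d fun _ => finitePart_apply_eq_zero f,
    ENNReal.toReal_sum fun _ _ => ENNReal.ofReal_ne_top]
  refine Finset.sum_congr rfl fun i hi => ?_
  rw [finitePart_apply, if_pos hi, Complex.ofReal_re,
    ENNReal.toReal_ofReal (mul_nonneg (hd i) (hf i))]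

section Order

variable [PartialOrder (lp (fun _ : ι => ℂ) ∞)] [StarOrderedRing (lp (fun _ : ι => ℂ) ∞)]

theorem lpInfty_nonneg_iff {a : lp (fun _ : ι => ℂ) ∞} : 0 ≤ a ↔ ∀ i, 0 ≤ a i := by
  constructor
  · intro ha i
    rw [StarOrderedRing.nonneg_iff] at ha
    induction ha using AddSubmonoid.closure_induction with
    | mem a ha =>
      obtain ⟨x, rfl⟩ := ha
      exact star_mul_self_nonneg (x i)
    | zero => exact le_rfl
    | add a b _ _ ha hb => exact add_nonneg ha hb
  · intro h
    let x : lp (fun _ : ι => ℂ) ∞ := ⟨_, memℓp_infty_sqrt_re a⟩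
    have hx : a = star x * x := lp.ext (funext fun i => by
      change a i = star ((Real.sqrt (a i).re : ℝ) : ℂ) * ((Real.sqrt (a i).re : ℝ) : ℂ)
      rw [Complex.star_def, Complex.conj_ofReal, ← Complex.ofReal_mul,
        Real.mul_self_sqrt (Complex.nonneg_iff.1 (h i)).1]
      exact Complex.eq_re_of_ofReal_le (r := 0) (by simpa only [Complex.ofReal_zero] using h i))
    exact hx ▸ star_mul_self_nonneg x

theorem lpInfty_le_iff {a b : lp (fun _ : ι => ℂ) ∞} : a ≤ b ↔ ∀ i, a i ≤ b i := by
  rw [← sub_nonneg, lpInfty_nonneg_iff]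
  exact forall_congr' fun i => sub_nonneg

theorem lpInfty_re_nonneg {a : lp (fun _ : ι => ℂ) ∞} (ha : 0 ≤ a) (i : ι) : 0 ≤ (a i).re :=
  (Complex.nonneg_iff.1 (lpInfty_nonneg_iff.1 ha i)).1

theorem lpInfty_re_le {a b : lp (fun _ : ι => ℂ) ∞} (hab : a ≤ b) (i : ι) :
    (a i).re ≤ (b i).re :=
  (Complex.le_def.1 (lpInfty_le_iff.1 hab i)).1

theorem lpInfty_eq_ofReal_re {a : lp (fun _ : ι => ℂ) ∞} (ha : 0 ≤ a) (i : ι) :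
    a i = ((a i).re : ℂ) :=
  Complex.ext rfl (Complex.nonneg_iff.1 (lpInfty_nonneg_iff.1 ha i)).2.symm

theorem IncreasesTo.isLUB_re_apply {E : Set (lp (fun _ : ι => ℂ) ∞)} {a : lp (fun _ : ι => ℂ) ∞}
    (h : IncreasesTo E a) (i : ι) :
    IsLUB ((fun d : lp (fun _ : ι => ℂ) ∞ => (d i).re) '' E) (a i).re := by
  classical
  obtain ⟨-, -, hpos, hlub⟩ := h
  refine ⟨Set.forall_mem_image.2 fun d hd => lpInfty_re_le (hlub.1 hd) i, fun M hM => ?_⟩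
  -- Changing the `i`-th coordinate of `a` to `M` gives another upper bound of `E`.
  let b : lp (fun _ : ι => ℂ) ∞ := a + lp.single ∞ i ((M : ℂ) - a i)
  have hbi : b i = M := by
    rw [lp.coeFn_add, Pi.add_apply, lp.single_apply_self, add_sub_cancel]
  have hb (j : ι) (hj : j ≠ i) : b j = a j := by
    rw [lp.coeFn_add, Pi.add_apply, lp.single_apply_ne _ _ _ hj, add_zero]
  have hub : b ∈ upperBounds E := fun d hd => lpInfty_le_iff.2 fun j => by
    rcases eq_or_ne j i with rfl | hj
    · rw [hbi, lpInfty_eq_ofReal_re (hpos d hd)]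
      exact Complex.real_le_real.2 (hM ⟨d, hd, rfl⟩)
    · rw [hb j hj]
      exact lpInfty_le_iff.1 (hlub.1 hd) j
  simpa only [hbi, Complex.ofReal_re] using lpInfty_re_le (hlub.2 hub) i

theorem lpInfty_norm_le_norm {a b : lp (fun _ : ι => ℂ) ∞} (ha : 0 ≤ a) (hab : a ≤ b) :
    ‖a‖ ≤ ‖b‖ := by
  refine lp.norm_le_of_forall_le (norm_nonneg b) fun i => ?_
  calc
    ‖a i‖ = (a i).re := by
      rw [lpInfty_eq_ofReal_re ha, Complex.norm_of_nonneg (lpInfty_re_nonneg ha i),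
        Complex.ofReal_re]
    _ ≤ (b i).re := lpInfty_re_le hab i
    _ ≤ ‖b i‖ := Complex.re_le_norm _
    _ ≤ ‖b‖ := lp.norm_apply_le_norm ENNReal.top_ne_zero b i

theorem isNormalFunctional_apply (i : ι) :
    IsNormalFunctional (lp.evalCLM ℂ (fun _ : ι => ℂ) ∞ i).toLinearMap :=
  ⟨fun _ ha => lpInfty_nonneg_iff.1 ha i, fun _ _ h => h.isLUB_re_apply i⟩

theorem continuous_ultraweak_apply (i : ι) :
    @Continuous _ ℂ (ultraweak (lp (fun _ : ι => ℂ) ∞)) inferInstance fun a => a i :=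
  continuous_iInf_dom (i := ⟨_, isNormalFunctional_apply i⟩) continuous_induced_dom

theorem weightedSum_add {d : ι → ℝ} (hd : ∀ i, 0 ≤ d i) {a b : lp (fun _ : ι => ℂ) ∞}
    (ha : 0 ≤ a) (hb : 0 ≤ b) : weightedSum d (a + b) = weightedSum d a + weightedSum d b := by
  rw [weightedSum, weightedSum, weightedSum, ← ENNReal.tsum_add]
  refine tsum_congr fun i => ?_
  rw [← ENNReal.ofReal_add (mul_nonneg (hd i) (lpInfty_re_nonneg ha i))
    (mul_nonneg (hd i) (lpInfty_re_nonneg hb i)), ← mul_add]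
  rfl

theorem eq_zero_of_weightedSum_eq_zero {d : ι → ℝ} (hd : ∀ i, 0 < d i)
    {a : lp (fun _ : ι => ℂ) ∞} (ha : 0 ≤ a) (h : weightedSum d a = 0) : a = 0 := by
  refine lp.ext (funext fun i => ?_)
  have hterm := ENNReal.ofReal_eq_zero.1 (ENNReal.tsum_eq_zero.1 h i)
  have hre : (a i).re = 0 :=
    (nonpos_of_mul_nonpos_right hterm (hd i)).antisymm (lpInfty_re_nonneg ha i)
  rw [lpInfty_eq_ofReal_re ha, hre]
  rfl

theorem ofReal_mul_re_eq_iSup {c : ℝ} (hc : 0 ≤ c) {E : Set (lp (fun _ : ι => ℂ) ∞)}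
    {a : lp (fun _ : ι => ℂ) ∞} (h : IncreasesTo E a) (i : ι) :
    ENNReal.ofReal (c * (a i).re) = ⨆ b : E, ENNReal.ofReal (c * (b.1 i).re) := by
  have hmono : Monotone fun x : ℝ => ENNReal.ofReal (c * x) := fun x y hxy =>
    ENNReal.ofReal_le_ofReal (mul_le_mul_of_nonneg_left hxy hc)
  have hcont : Continuous fun x : ℝ => ENNReal.ofReal (c * x) :=
    ENNReal.continuous_ofReal.comp (continuous_const_mul c)
  have hlub := h.isLUB_re_apply i
  have hsup := hmono.map_csSup_of_continuousAt hcont.continuousAt (h.1.image _) ⟨_, hlub.1⟩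
  rwa [hlub.csSup_eq (h.1.image _), Set.image_image, sSup_image'] at hsup

theorem weightedSum_eq_iSup {d : ι → ℝ} (hd : ∀ i, 0 ≤ d i) {E : Set (lp (fun _ : ι => ℂ) ∞)}
    {a : lp (fun _ : ι => ℂ) ∞} (h : IncreasesTo E a) :
    weightedSum d a = ⨆ b ∈ E, weightedSum d b := by
  have hmono (b c : lp (fun _ : ι => ℂ) ∞) (hbc : b ≤ c) (i : ι) :
      ENNReal.ofReal (d i * (b i).re) ≤ ENNReal.ofReal (d i * (c i).re) :=
    ENNReal.ofReal_le_ofReal (mul_le_mul_of_nonneg_left (lpInfty_re_le hbc i) (hd i))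
  calc
    weightedSum d a = ⨆ s : Finset ι, ∑ i ∈ s, ⨆ b : E, ENNReal.ofReal (d i * (b.1 i).re) := by
      rw [weightedSum, ENNReal.tsum_eq_iSup_sum]
      simp_rw [ofReal_mul_re_eq_iSup (hd _) h]
    _ = ⨆ s : Finset ι, ⨆ b : E, ∑ i ∈ s, ENNReal.ofReal (d i * (b.1 i).re) := by
      refine iSup_congr fun s => ENNReal.finsetSum_iSup fun b c => ?_
      obtain ⟨e, he, hbe, hce⟩ := h.2.1 b.1 b.2 c.1 c.2
      exact ⟨⟨e, he⟩, fun i => ⟨hmono _ _ hbe i, hmono _ _ hce i⟩⟩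
    _ = ⨆ b ∈ E, weightedSum d b := by
      rw [iSup_comm, iSup_subtype']
      exact iSup_congr fun b => ENNReal.tsum_eq_iSup_sum.symm

theorem exists_le_weightedSum_lt_top (d : ι → ℝ) {a : lp (fun _ : ι => ℂ) ∞} (ha : 0 ≤ a)
    (hne : a ≠ 0) :
    ∃ b : lp (fun _ : ι => ℂ) ∞, 0 ≤ b ∧ b ≤ a ∧ b ≠ 0 ∧ weightedSum d b < ∞ := by
  classical
  obtain ⟨i, hi⟩ : ∃ i, a i ≠ 0 := by
    by_contra! hzero
    exact hne (lp.ext (funext hzero))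
  have hself : lp.single (E := fun _ : ι => ℂ) ∞ i (a i) i = a i := lp.single_apply_self _ _ _
  have hother (j : ι) (hj : j ≠ i) : lp.single (E := fun _ : ι => ℂ) ∞ i (a i) j = 0 :=
    lp.single_apply_ne _ _ _ hj
  refine ⟨lp.single ∞ i (a i), lpInfty_nonneg_iff.2 fun j => ?_, lpInfty_le_iff.2 fun j => ?_,
    fun hzero => hi ?_, weightedSum_lt_top d (s := {i}) fun j hj =>
      hother j (Finset.notMem_singleton.1 hj)⟩
  · rcases eq_or_ne j i with rfl | hj
    · rw [hself]
      exact lpInfty_nonneg_iff.1 ha j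
    · rw [hother j hj]
  · rcases eq_or_ne j i with rfl | hj
    · rw [hself]
    · rw [hother j hj]
      exact lpInfty_nonneg_iff.1 ha j
  · rw [← hself, hzero]
    rfl

theorem isNSFTrace_weightedSum {d : ι → ℝ} (hd : ∀ i, 0 < d i) : IsNSFTrace (weightedSum d) where
  map_add _ _ := weightedSum_add fun i => (hd i).le
  map_smul r a _ := weightedSum_smul d r a
  tracial a := by rw [mul_comm]
  faithful _ := eq_zero_of_weightedSum_eq_zero hd
  normal _ _ := weightedSum_eq_iSup fun i => (hd i).le
  semifinite _ := exists_le_weightedSum_lt_top d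

theorem finitePart_nonneg (s : Finset ι) {f : ι → ℝ} (hf : 0 ≤ f) :
    0 ≤ finitePart s f := by
  refine lpInfty_nonneg_iff.2 fun i => ?_
  classical
  rw [finitePart_apply]
  split_ifs
  exacts [Complex.zero_le_real.2 (hf i), le_rfl]

theorem isFiniteDecomposition_finitePart (d : ι → ℝ) {s : Finset ι} {a : lp (fun _ : ι => ℂ) ∞}
    (ha : ∀ i ∉ s, a i = 0) :
    IsFiniteDecomposition (weightedSum d) a
      (finitePart s (fun i => (a i).re)⁺, finitePart s (fun i => (a i).re)⁻,
        finitePart s (fun i => (a i).im)⁺, finitePart s (fun i => (a i).im)⁻) := by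
  have hpos (f : ι → ℝ) : 0 ≤ finitePart s f⁺ := finitePart_nonneg s (posPart_nonneg f)
  have hneg (f : ι → ℝ) : 0 ≤ finitePart s f⁻ := finitePart_nonneg s (negPart_nonneg f)
  have hfin (f : ι → ℝ) : weightedSum d (finitePart s f) < ∞ :=
    weightedSum_lt_top d fun _ => finitePart_apply_eq_zero f
  refine ⟨⟨hpos _, hneg _, hpos _, hneg _⟩, ⟨hfin _, hfin _, hfin _, hfin _⟩, ?_⟩
  classical
  rw [← finitePart_sub, ← finitePart_sub, posPart_sub_negPart, posPart_sub_negPart]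
  refine lp.ext (funext fun i => ?_)
  rw [lp.coeFn_add, Pi.add_apply, lp.coeFn_smul, Pi.smul_apply, finitePart_apply,
    finitePart_apply, smul_eq_mul]
  split_ifs with hi
  · rw [mul_comm, Complex.re_add_im]
  · rw [ha i hi, mul_zero, add_zero]

theorem extend_weightedSum {d : ι → ℝ} (hd : ∀ i, 0 < d i) {s : Finset ι}
    {a : lp (fun _ : ι => ℂ) ∞} (ha : ∀ i ∉ s, a i = 0) :
    extend (weightedSum d) a = ∑ i ∈ s, d i * a i := by
  have htau {f : ι → ℝ} (hf : 0 ≤ f) :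
      (weightedSum d (finitePart s f)).toReal = ∑ i ∈ s, d i * f i :=
    toReal_weightedSum_finitePart (fun i => (hd i).le) s hf
  have hparts (f : ι → ℝ) :
      ∑ i ∈ s, d i * f⁺ i - ∑ i ∈ s, d i * f⁻ i = ∑ i ∈ s, d i * f i := by
    simp_rw [← Finset.sum_sub_distrib, ← mul_sub]
    exact Finset.sum_congr rfl fun i _ => congrArg (d i * ·) (congrFun (posPart_sub_negPart f) i)
  rw [extend_eq (isNSFTrace_weightedSum hd) (isFiniteDecomposition_finitePart d ha),
    htau (posPart_nonneg _), htau (negPart_nonneg _), htau (posPart_nonneg _),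
    htau (negPart_nonneg _), hparts, hparts, Complex.ofReal_sum, Complex.ofReal_sum,
    Finset.mul_sum, ← Finset.sum_add_distrib]
  refine Finset.sum_congr rfl fun i _ => ?_
  rw [Complex.ofReal_mul, Complex.ofReal_mul, mul_left_comm, ← mul_add, mul_comm Complex.I,
    Complex.re_add_im]

end Order

end LpInfty

end TomitaBimodule

/-! ### The bimodule `H(𝟙)` -/

namespace TomitaFromCategory

open CStarCategory TomitaBimodule

theorem continuous_sum_mul_const {ι T : Type*} [TopologicalSpace T] {s : Finset ι}
    {e : ι → T → ℂ} (he : ∀ i, Continuous (e i)) (k : ι → ℂ) :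
    Continuous fun a => ∑ i ∈ s, e i a * k i := by fun_prop

theorem star_ofReal_cpow {r : ℝ} (hr : 0 < r) (w : ℂ) : star ((r : ℂ) ^ w) = (r : ℂ) ^ star w := by
  rw [Complex.star_def, Complex.cpow_conj _ _ ?_, Complex.conj_ofReal]
  rw [Complex.arg_ofReal_of_nonneg hr.le]
  exact Real.pi_pos.ne

variable {C : Type u} [Category.{v} C] [Preadditive C] [Linear ℂ C] [MonoidalCategory C]
  {R : Representatives C}

theorem Triple.bar_involutive : Function.Involutive (Triple.bar : Triple R → Triple R) :=
  fun t => Prod.ext rfl (Prod.ext rfl (Sum.swap_swap t.2.2))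

section LetterScalar

variable {lam : R.Idx → ℝ}

theorem letterScalar_bar (lam : R.Idx → ℝ) (l : Letter R) :
    letterScalar lam (Letter.bar l) = (letterScalar lam l)⁻¹ := by
  rcases l with a | a
  · exact one_div _
  · exact (one_div_one_div (lam a)).symm.trans (one_div _)

theorem letterScalar_pos (hlam : ∀ a, 0 < lam a) (l : Letter R) : 0 < letterScalar lam l := by
  rcases l with a | a
  · exact hlam a
  · exact one_div_pos.2 (hlam a)

theorem letterScalar_ne_zero (hlam : ∀ a, 0 < lam a) (l : Letter R) :
    (letterScalar lam l : ℂ) ≠ 0 :=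
  Complex.ofReal_ne_zero.2 (letterScalar_pos hlam l).ne'

theorem star_letterScalar_cpow (hlam : ∀ a, 0 < lam a) (l : Letter R) (z : ℂ) :
    star ((letterScalar lam l : ℂ) ^ (Complex.I * z)) =
      (letterScalar lam l : ℂ) ^ (Complex.I * -star z) := by
  rw [star_ofReal_cpow (letterScalar_pos hlam l), star_mul', Complex.star_def, Complex.conj_I,
    neg_mul_comm]

theorem star_letterScalar_cpow_eq_bar (hlam : ∀ a, 0 < lam a) (l : Letter R) (z : ℂ) :
    star ((letterScalar lam l : ℂ) ^ (Complex.I * z)) =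
      (letterScalar lam (Letter.bar l) : ℂ) ^ (Complex.I * star z) := by
  rw [star_letterScalar_cpow hlam, letterScalar_bar, Complex.ofReal_inv, Complex.inv_cpow,
    ← Complex.cpow_neg, mul_neg]
  rw [Complex.arg_ofReal_of_nonneg (letterScalar_pos hlam l).le]
  exact Real.pi_pos.ne

theorem differentiable_letterScalar_cpow (hlam : ∀ a, 0 < lam a) (l : Letter R) :
    Differentiable ℂ fun z : ℂ => (letterScalar lam l : ℂ) ^ (Complex.I * z) := fun _ =>
  (differentiableAt_id.const_mul Complex.I).const_cpow (Or.inl (letterScalar_ne_zero hlam l))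

theorem sqrt_letterScalar_bar_mul_sqrt_letterScalar (hlam : ∀ a, 0 < lam a) (l : Letter R) :
    Real.sqrt (letterScalar lam (Letter.bar l)) * Real.sqrt (letterScalar lam l) = 1 := by
  have hpos := letterScalar_pos hlam l
  rw [letterScalar_bar, ← Real.sqrt_mul (inv_pos.2 hpos).le, inv_mul_cancel₀ hpos.ne',
    Real.sqrt_one]

end LetterScalar

namespace StandardConjugates

variable [MonoidalPreadditive C] [MonoidalLinear ℂ C] [RigidCStarTensorCategory C]
variable (D : StandardConjugates R)

/-- The inner product `ξ* ζ ∈ End β₁ = ℂ` on `Hom(β₁, β₂ α)`, one summand of `ip`. -/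
def homInner {t : Triple R} (ξ ζ : D.HomSpace t) : ℂ := coeff (D.toHom ζ ≫ dag (D.toHom ξ))

section HomInner

variable {t : Triple R}

theorem homInner_add_left (ξ₁ ξ₂ ζ : D.HomSpace t) :
    D.homInner (ξ₁ + ξ₂) ζ = D.homInner ξ₁ ζ + D.homInner ξ₂ ζ := by
  refine Eq.trans (congrArg coeff ?_) ((R.simple _ t.1.2).coeff_add _ _)
  exact (congrArg (D.toHom ζ ≫ ·) (dag_add _ _)).trans (Preadditive.comp_add _ _ _ _ _ _)

theorem homInner_add_right (ξ ζ₁ ζ₂ : D.HomSpace t) :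
    D.homInner ξ (ζ₁ + ζ₂) = D.homInner ξ ζ₁ + D.homInner ξ ζ₂ :=
  Eq.trans (congrArg coeff (Preadditive.add_comp _ _ _ _ _ _)) ((R.simple _ t.1.2).coeff_add _ _)

theorem homInner_smul_left (c : ℂ) (ξ ζ : D.HomSpace t) :
    D.homInner (c • ξ) ζ = star c * D.homInner ξ ζ := by
  refine Eq.trans (congrArg coeff ?_) ((R.simple _ t.1.2).coeff_smul _ _)
  exact (congrArg (D.toHom ζ ≫ ·) (dag_smul _ _)).trans (Linear.comp_smul _ _ _ _ _ _)

theorem homInner_smul_right (c : ℂ) (ξ ζ : D.HomSpace t) :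
    D.homInner ξ (c • ζ) = c * D.homInner ξ ζ :=
  Eq.trans (congrArg coeff (Linear.smul_comp _ _ _ _ _ _)) ((R.simple _ t.1.2).coeff_smul _ _)

theorem homInner_zero_left (ζ : D.HomSpace t) : D.homInner 0 ζ = 0 := by
  rw [← zero_smul ℂ (0 : D.HomSpace t), homInner_smul_left, star_zero, zero_mul]

theorem homInner_self_nonneg (ξ : D.HomSpace t) : 0 ≤ D.homInner ξ ξ :=
  (R.simple _ t.1.2).coeff_comp_dag_nonneg _

theorem eq_zero_of_homInner_self_eq_zero {ξ : D.HomSpace t} (h : D.homInner ξ ξ = 0) : ξ = 0 :=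
  (R.simple _ t.1.2).eq_zero_of_coeff_comp_dag_eq_zero h

theorem homConjHom_smul (c : ℂ) (ξ : D.HomSpace t) :
    D.homConjHom t (c • ξ) = star c • D.homConjHom t ξ := by
  change D.homConj t (c • D.toHom ξ) = star c • D.homConj t (D.toHom ξ)
  simp only [homConj, dag_smul, MonoidalLinear.smul_whiskerRight, Linear.comp_smul]

theorem dim_mul_homInner_homConjHom (ξ ζ : D.HomSpace t) :
    D.dim t.2.1 * D.homInner (D.homConjHom t ξ) (D.homConjHom t ζ) =
      D.dim t.1 * D.homInner ζ ξ :=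
  D.dim_mul_coeff_homConj t ξ ζ

end HomInner

theorem left_smul_apply (a : Alg R) (ξ : D.Hbim) (t : Triple R) : (a • ξ) t = a t.2.1 • ξ t := rfl

theorem right_smul_apply (a : Alg R) (ξ : D.Hbim) (t : Triple R) :
    (MulOpposite.op a • ξ) t = a t.1 • ξ t := rfl

open Classical in
theorem ip_eq_sum {ξ : D.Hbim} (ζ : D.Hbim) {s : Finset (Triple R)} (hs : ∀ t ∉ s, ξ t = 0) :
    D.ip ξ ζ = ∑ t ∈ s, lp.single ∞ t.1 (D.homInner (ξ t) (ζ t)) := by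
  refine Finset.sum_subset (fun t ht => ?_) fun t _ ht => ?_
  · by_contra h
    exact DFinsupp.mem_support_iff.1 ht (hs t h)
  · change (lp.single ∞ t.1 (D.homInner (ξ t) (ζ t)) : Alg R) = 0
    rw [DFinsupp.notMem_support_iff.1 ht, homInner_zero_left, lp.single_zero]

open Classical in
theorem ip_apply {ξ : D.Hbim} (ζ : D.Hbim) {s : Finset (Triple R)} (hs : ∀ t ∉ s, ξ t = 0)
    (β : R.Idx) :
    D.ip ξ ζ β = ∑ t ∈ s, if t.1 = β then D.homInner (ξ t) (ζ t) else 0 := by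
  rw [D.ip_eq_sum ζ hs, lp.coeFn_sum, Finset.sum_apply]
  refine Finset.sum_congr rfl fun t _ => ?_
  rw [lp.single_apply, Pi.single_apply]
  exact if_congr eq_comm rfl rfl

open Classical in
theorem ip_apply_eq_zero {ξ : D.Hbim} (ζ : D.Hbim) {s : Finset (Triple R)}
    (hs : ∀ t ∉ s, ξ t = 0) {β : R.Idx} (hβ : β ∉ s.image Prod.fst) : D.ip ξ ζ β = 0 := by
  rw [D.ip_apply ζ hs]
  exact Finset.sum_eq_zero fun t ht => if_neg fun h : t.1 = β =>
    hβ (h ▸ Finset.mem_image_of_mem _ ht)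

theorem tau_ip_self_lt_top (ξ : D.Hbim) : D.tau (D.ip ξ ξ) < ∞ := by
  classical
  exact weightedSum_lt_top D.dim fun _ =>
    D.ip_apply_eq_zero ξ fun _ => DFinsupp.notMem_support_iff.1

theorem scalarInner_eq_sum {ξ : D.Hbim} (ζ : D.Hbim) {s : Finset (Triple R)}
    (hs : ∀ t ∉ s, ξ t = 0) :
    scalarInner D.tau D.ip ξ ζ = ∑ t ∈ s, D.dim t.1 * D.homInner (ξ t) (ζ t) := by
  classical
  rw [scalarInner]
  refine (extend_weightedSum D.dim_pos fun β => D.ip_apply_eq_zero ζ hs).trans ?_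
  simp_rw [D.ip_apply ζ hs, Finset.mul_sum]
  rw [Finset.sum_comm]
  refine Finset.sum_congr rfl fun t ht => ?_
  rw [Finset.sum_eq_single_of_mem t.1 (Finset.mem_image_of_mem _ ht) fun β _ hβ => by
    rw [if_neg hβ.symm, mul_zero], if_pos rfl]

theorem ip_add_left (ξ₁ ξ₂ ζ : D.Hbim) : D.ip (ξ₁ + ξ₂) ζ = D.ip ξ₁ ζ + D.ip ξ₂ ζ := by
  classical
  refine DFinsupp.sum_add_index
    (h := fun (t : Triple R) ξ => (lp.single ∞ t.1 (D.homInner ξ (ζ t)) : Alg R))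
    (fun t => ?_) fun t ξ ξ' => ?_
  · rw [homInner_zero_left, lp.single_zero]
  · rw [homInner_add_left, lp.single_add]

theorem ip_add_right (ξ ζ₁ ζ₂ : D.Hbim) : D.ip ξ (ζ₁ + ζ₂) = D.ip ξ ζ₁ + D.ip ξ ζ₂ := by
  classical
  have hξ : ∀ t ∉ DFinsupp.support ξ, ξ t = 0 := fun _ => DFinsupp.notMem_support_iff.1
  simp_rw [D.ip_eq_sum _ hξ, DirectSum.add_apply, homInner_add_right, lp.single_add,
    Finset.sum_add_distrib]

theorem ip_smul_left (c : ℂ) (ξ ζ : D.Hbim) : D.ip (c • ξ) ζ = star c • D.ip ξ ζ := by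
  classical
  have hξ : ∀ t ∉ DFinsupp.support ξ, ξ t = 0 := fun _ => DFinsupp.notMem_support_iff.1
  have hcξ : ∀ t ∉ DFinsupp.support ξ, (c • ξ) t = 0 := fun t ht => by
    rw [DirectSum.smul_apply, hξ t ht, smul_zero]
  simp_rw [D.ip_eq_sum _ hcξ, D.ip_eq_sum _ hξ, DirectSum.smul_apply, homInner_smul_left,
    ← smul_eq_mul, lp.single_smul, Finset.smul_sum]

theorem ip_smul_right (c : ℂ) (ξ ζ : D.Hbim) : D.ip ξ (c • ζ) = c • D.ip ξ ζ := by
  classical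
  have hξ : ∀ t ∉ DFinsupp.support ξ, ξ t = 0 := fun _ => DFinsupp.notMem_support_iff.1
  simp_rw [D.ip_eq_sum _ hξ, DirectSum.smul_apply, homInner_smul_right, ← smul_eq_mul,
    lp.single_smul, Finset.smul_sum]

theorem ip_action (a b : Alg R) (ξ ζ : D.Hbim) :
    D.ip ξ (b • (MulOpposite.op a • ζ)) = D.ip (star b • ξ) ζ * a := by
  classical
  have hξ : ∀ t ∉ DFinsupp.support ξ, ξ t = 0 := fun _ => DFinsupp.notMem_support_iff.1
  have hbξ : ∀ t ∉ DFinsupp.support ξ, (star b • ξ) t = 0 := fun t ht => by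
    rw [left_smul_apply, hξ t ht, smul_zero]
  refine lp.ext (funext fun β => ?_)
  rw [lp.infty_coeFn_mul, Pi.mul_apply, D.ip_apply _ hξ, D.ip_apply _ hbξ, Finset.sum_mul]
  refine Finset.sum_congr rfl fun t _ => ?_
  split_ifs with hβ
  · rw [left_smul_apply, right_smul_apply, left_smul_apply, homInner_smul_right,
      homInner_smul_right, homInner_smul_left, lp.star_apply, star_star, hβ, mul_left_comm,
      mul_comm]
  · rw [zero_mul]

theorem ip_self_nonneg (ξ : D.Hbim) : 0 ≤ D.ip ξ ξ := by
  classical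
  refine lpInfty_nonneg_iff.2 fun β => ?_
  rw [D.ip_apply ξ fun _ => DFinsupp.notMem_support_iff.1]
  refine Finset.sum_nonneg fun t _ => ?_
  split_ifs
  exacts [D.homInner_self_nonneg _, le_rfl]

theorem eq_zero_of_ip_self_eq_zero {ξ : D.Hbim} (h : D.ip ξ ξ = 0) : ξ = 0 := by
  classical
  have hterm (β : R.Idx) (t : Triple R) :
      0 ≤ if t.1 = β then D.homInner (ξ t) (ξ t) else 0 := by
    split_ifs
    exacts [D.homInner_self_nonneg _, le_rfl]
  refine DFinsupp.ext fun t => ?_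
  by_contra ht
  have hsum := congrArg (fun a : Alg R => a t.1) h
  dsimp only at hsum
  rw [D.ip_apply ξ fun _ => DFinsupp.notMem_support_iff.1] at hsum
  have hzero := (Finset.sum_eq_zero_iff_of_nonneg fun u _ => hterm t.1 u).1 hsum t
    (DFinsupp.mem_support_iff.2 ht)
  rw [if_pos rfl] at hzero
  exact ht (D.eq_zero_of_homInner_self_eq_zero hzero)

theorem ip_left_smul_self_le (a : Alg R) (ξ : D.Hbim) :
    D.ip (a • ξ) (a • ξ) ≤ ((‖a‖ ^ 2 : ℝ) : ℂ) • D.ip ξ ξ := by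
  classical
  have hξ : ∀ t ∉ DFinsupp.support ξ, ξ t = 0 := fun _ => DFinsupp.notMem_support_iff.1
  have haξ : ∀ t ∉ DFinsupp.support ξ, (a • ξ) t = 0 := fun t ht => by
    rw [left_smul_apply, hξ t ht, smul_zero]
  refine lpInfty_le_iff.2 fun β => ?_
  rw [lp.coeFn_smul, Pi.smul_apply, D.ip_apply _ haξ, D.ip_apply _ hξ, Finset.smul_sum]
  refine Finset.sum_le_sum fun t _ => ?_
  split_ifs
  · rw [left_smul_apply, homInner_smul_left, homInner_smul_right, ← mul_assoc, smul_eq_mul]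
    refine mul_le_mul_of_nonneg_right ?_ (D.homInner_self_nonneg _)
    rw [Complex.star_def, ← Complex.normSq_eq_conj_mul_self, Complex.normSq_eq_norm_sq]
    exact Complex.real_le_real.2 (pow_le_pow_left₀ (norm_nonneg _)
      (lp.norm_apply_le_norm ENNReal.top_ne_zero a _) 2)
  · rw [smul_zero]

theorem moduleNorm_left_smul_le (a : Alg R) (ξ : D.Hbim) :
    moduleNorm D.ip (a • ξ) ≤ ‖a‖ * moduleNorm D.ip ξ := by
  have hnorm := lpInfty_norm_le_norm (D.ip_self_nonneg (a • ξ)) (D.ip_left_smul_self_le a ξ)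
  rw [norm_smul, Complex.norm_real, Real.norm_of_nonneg (sq_nonneg _)] at hnorm
  calc
    moduleNorm D.ip (a • ξ) ≤ Real.sqrt (‖a‖ ^ 2 * ‖D.ip ξ ξ‖) := Real.sqrt_le_sqrt hnorm
    _ = ‖a‖ * moduleNorm D.ip ξ := by
      rw [Real.sqrt_mul (sq_nonneg _), Real.sqrt_sq (norm_nonneg _), moduleNorm]

theorem isPreHilbertBimodule : IsPreHilbertBimodule (A := Alg R) D.ip where
  left_scalar _ _ := DFinsupp.ext fun _ => rfl
  right_scalar _ _ := DFinsupp.ext fun _ => rfl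
  left_right a b ξ := DFinsupp.ext fun t => smul_comm (a t.2.1) (b t.1) (ξ t)
  add_left := D.ip_add_left
  add_right := D.ip_add_right
  smul_left := D.ip_smul_left
  smul_right := D.ip_smul_right
  ip_action := D.ip_action
  ip_nonneg := D.ip_self_nonneg
  ip_definite _ := D.eq_zero_of_ip_self_eq_zero
  norm_left_action := D.moduleNorm_left_smul_le

open Classical in
theorem map_ip_left_smul (φ : Alg R →ₗ[ℂ] ℂ) (ξ : D.Hbim) (a : Alg R) :
    φ (D.ip ξ (a • ξ)) = ∑ t ∈ DFinsupp.support ξ,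
      a t.2.1 * φ (lp.single ∞ t.1 (D.homInner (ξ t) (ξ t))) := by
  rw [D.ip_eq_sum _ fun _ => DFinsupp.notMem_support_iff.1, map_sum]
  refine Finset.sum_congr rfl fun t _ => ?_
  rw [left_smul_apply, homInner_smul_right, ← smul_eq_mul, lp.single_smul, map_smul, smul_eq_mul]

theorem hasNormalLeftAction : HasNormalLeftAction (A := Alg R) D.ip := by
  intro ξ
  refine @Continuous.continuousOn _ _ (ultraweak (Alg R)) (ultraweak (Alg R)) _ _ ?_
  refine continuous_iInf_rng.2 fun φ => continuous_induced_rng.2 ?_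
  rw [show (φ.1 ∘ fun a : Alg R => D.ip ξ (a • ξ)) = _ from funext (D.map_ip_left_smul φ.1 ξ)]
  exact @continuous_sum_mul_const _ _ (ultraweak (Alg R)) _
    (fun (t : Triple R) (a : Alg R) => a t.2.1) (fun t => continuous_ultraweak_apply t.2.1) _

section OneParam

variable {lam : R.Idx → ℝ}

theorem oneParam_apply (lam : R.Idx → ℝ) (z : ℂ) (ξ : D.Hbim) (t : Triple R) :
    D.oneParam lam z ξ t = (letterScalar lam t.2.2 : ℂ) ^ (Complex.I * z) • ξ t := by
  rw [oneParam, DirectSum.lmap_apply]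
  rfl

theorem oneParam_zero (ξ : D.Hbim) : D.oneParam lam 0 ξ = ξ :=
  DFinsupp.ext fun t => by rw [oneParam_apply, mul_zero, Complex.cpow_zero, one_smul]

theorem oneParam_add (hlam : ∀ a, 0 < lam a) (z w : ℂ) (ξ : D.Hbim) :
    D.oneParam lam (z + w) ξ = D.oneParam lam z (D.oneParam lam w ξ) :=
  DFinsupp.ext fun t => by
    rw [oneParam_apply, oneParam_apply, oneParam_apply, smul_smul, mul_add,
      Complex.cpow_add _ _ (letterScalar_ne_zero hlam _)]

theorem oneParam_bijective (hlam : ∀ a, 0 < lam a) (z : ℂ) :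
    Function.Bijective (D.oneParam lam z) :=
  Function.bijective_iff_has_inverse.2 ⟨D.oneParam lam (-z),
    fun ξ => by rw [← D.oneParam_add hlam, neg_add_cancel, D.oneParam_zero],
    fun ξ => by rw [← D.oneParam_add hlam, add_neg_cancel, D.oneParam_zero]⟩

theorem oneParam_action (z : ℂ) (a b : Alg R) (ξ : D.Hbim) :
    D.oneParam lam z (a • (MulOpposite.op b • ξ)) =
      a • (MulOpposite.op b • D.oneParam lam z ξ) :=
  DFinsupp.ext fun t => by
    simp_rw [oneParam_apply, left_smul_apply, right_smul_apply, oneParam_apply]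
    rw [smul_comm, smul_comm _ (b t.1)]

theorem continuous_moduleNorm_oneParam_sub (hlam : ∀ a, 0 < lam a) (ζ : D.Hbim) (z₀ : ℂ) :
    Continuous fun z => moduleNorm D.ip (D.oneParam lam z ζ - D.oneParam lam z₀ ζ) := by
  classical
  let w (t : Triple R) (z : ℂ) : ℂ := (letterScalar lam t.2.2 : ℂ) ^ (Complex.I * z) -
    (letterScalar lam t.2.2 : ℂ) ^ (Complex.I * z₀)
  have hw (t : Triple R) : Continuous (w t) :=
    (differentiable_letterScalar_cpow hlam t.2.2).continuous.sub continuous_const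
  have hsub (z : ℂ) (t : Triple R) :
      (D.oneParam lam z ζ - D.oneParam lam z₀ ζ) t = w t z • ζ t := by
    rw [DirectSum.sub_apply, oneParam_apply, oneParam_apply, ← sub_smul]
  have hzero (z : ℂ) : ∀ t ∉ DFinsupp.support ζ,
      (D.oneParam lam z ζ - D.oneParam lam z₀ ζ) t = 0 := fun t ht => by
    rw [hsub, DFinsupp.notMem_support_iff.1 ht, smul_zero]
  simp_rw [moduleNorm, D.ip_eq_sum _ (hzero _), hsub, homInner_smul_left, homInner_smul_right]
  refine Real.continuous_sqrt.comp (continuous_norm.comp (continuous_finsetSum _ fun t _ => ?_))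
  exact (lp.isometry_single t.1).continuous.comp ((hw t).star.mul ((hw t).mul continuous_const))

theorem tendsto_moduleNorm_oneParam_sub (hlam : ∀ a, 0 < lam a) (ζ : D.Hbim) (z₀ : ℂ) :
    Filter.Tendsto (fun z => moduleNorm D.ip (D.oneParam lam z ζ - D.oneParam lam z₀ ζ))
      (nhds z₀) (nhds 0) := by
  have hzero : moduleNorm D.ip (D.oneParam lam z₀ ζ - D.oneParam lam z₀ ζ) = 0 := by
    rw [sub_self, moduleNorm, D.ip_eq_sum (s := ∅) _ fun _ _ => rfl, Finset.sum_empty, norm_zero,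
      Real.sqrt_zero]
  exact hzero ▸ (D.continuous_moduleNorm_oneParam_sub hlam ζ z₀).tendsto z₀

theorem differentiable_scalarInner_oneParam (hlam : ∀ a, 0 < lam a) (ξ ζ : D.Hbim) :
    Differentiable ℂ fun z => scalarInner D.tau D.ip ξ (D.oneParam lam z ζ) := by
  classical
  have hξ : ∀ t ∉ DFinsupp.support ξ, ξ t = 0 := fun _ => DFinsupp.notMem_support_iff.1
  simp_rw [D.scalarInner_eq_sum _ hξ, oneParam_apply, homInner_smul_right]
  exact Differentiable.fun_sum fun t _ =>
    ((differentiable_letterScalar_cpow hlam t.2.2).mul_const _).const_mul _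

theorem scalarInner_oneParam (hlam : ∀ a, 0 < lam a) (z : ℂ) (ξ ζ : D.Hbim) :
    scalarInner D.tau D.ip ξ (D.oneParam lam z ζ) =
      scalarInner D.tau D.ip (D.oneParam lam (-star z) ξ) ζ := by
  classical
  have hξ : ∀ t ∉ DFinsupp.support ξ, ξ t = 0 := fun _ => DFinsupp.notMem_support_iff.1
  have hUξ : ∀ t ∉ DFinsupp.support ξ, D.oneParam lam (-star z) ξ t = 0 := fun t ht => by
    rw [oneParam_apply, hξ t ht, smul_zero]
  simp_rw [D.scalarInner_eq_sum _ hξ, D.scalarInner_eq_sum _ hUξ, oneParam_apply,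
    homInner_smul_right, homInner_smul_left, star_letterScalar_cpow hlam, star_neg, star_star,
    neg_neg]

end OneParam

section Invol

variable {lam : R.Idx → ℝ}

open Classical in
theorem invol_of (lam : R.Idx → ℝ) (t : Triple R) (ξ : D.HomSpace t) :
    D.invol lam (DirectSum.of D.HomSpace t ξ) = DirectSum.of D.HomSpace (Triple.bar t)
      (((Real.sqrt (letterScalar lam t.2.2) : ℝ) : ℂ) • D.homConjHom t ξ) :=
  DirectSum.toAddMonoid_of _ _ _

theorem invol_apply_bar (lam : R.Idx → ℝ) (ξ : D.Hbim) (t : Triple R) :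
    D.invol lam ξ (Triple.bar t) =
      ((Real.sqrt (letterScalar lam t.2.2) : ℝ) : ℂ) • D.homConjHom t (ξ t) := by
  classical
  induction ξ using DirectSum.induction_on with
  | zero => rw [map_zero, DirectSum.zero_apply, DirectSum.zero_apply, map_zero, smul_zero]
  | of u ξ =>
    rw [invol_of]
    by_cases h : u = t
    · subst h
      rw [DirectSum.of_eq_same, DirectSum.of_eq_same]
    · rw [DirectSum.of_eq_of_ne u t ξ (Ne.symm h), map_zero, smul_zero]
      exact DirectSum.of_eq_of_ne _ _ _ fun h' => h (Triple.bar_involutive.injective h'.symm)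
  | add ξ ζ hξ hζ =>
    rw [map_add, DirectSum.add_apply, DirectSum.add_apply, hξ, hζ, map_add, smul_add]

theorem invol_invol (hlam : ∀ a, 0 < lam a) (ξ : D.Hbim) : D.invol lam (D.invol lam ξ) = ξ := by
  classical
  induction ξ using DirectSum.induction_on with
  | zero => rw [map_zero, map_zero]
  | of t ξ =>
    rw [invol_of, invol_of, homConjHom_smul, Complex.star_def, Complex.conj_ofReal, smul_smul,
      ← Complex.ofReal_mul, sqrt_letterScalar_bar_mul_sqrt_letterScalar hlam, Complex.ofReal_one,
      one_smul]
    exact D.of_homConjHom_homConjHom t ξ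
  | add ξ ζ hξ hζ => rw [map_add, map_add, hξ, hζ]

theorem hbim_ext_bar {ξ ζ : D.Hbim} (h : ∀ t, ξ (Triple.bar t) = ζ (Triple.bar t)) : ξ = ζ :=
  DFinsupp.ext (Triple.bar_involutive.surjective.forall.2 h)

theorem invol_oneParam (hlam : ∀ a, 0 < lam a) (z : ℂ) (ξ : D.Hbim) :
    D.invol lam (D.oneParam lam z ξ) = D.oneParam lam (star z) (D.invol lam ξ) :=
  D.hbim_ext_bar fun t => by
    rw [invol_apply_bar, oneParam_apply, oneParam_apply, invol_apply_bar, homConjHom_smul,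
      star_letterScalar_cpow_eq_bar hlam, smul_comm]

theorem invol_smul (c : ℂ) (ξ : D.Hbim) : D.invol lam (c • ξ) = star c • D.invol lam ξ :=
  D.hbim_ext_bar fun t => by
    rw [invol_apply_bar, DirectSum.smul_apply, DirectSum.smul_apply, invol_apply_bar,
      homConjHom_smul, smul_comm]

theorem invol_action (a b : Alg R) (ξ : D.Hbim) :
    D.invol lam (a • (MulOpposite.op b • ξ)) =
      star b • (MulOpposite.op (star a) • D.invol lam ξ) :=
  D.hbim_ext_bar fun t => by
    rw [invol_apply_bar, left_smul_apply, left_smul_apply, right_smul_apply, right_smul_apply,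
      invol_apply_bar, homConjHom_smul, homConjHom_smul, lp.star_apply, lp.star_apply, smul_comm,
      smul_comm _ (star (b t.1)), smul_comm (star (a t.2.1)) (star (b t.1))]

theorem scalarInner_invol (hlam : ∀ a, 0 < lam a) (ξ ζ : D.Hbim) :
    scalarInner D.tau D.ip (D.invol lam ξ) (D.invol lam ζ) =
      scalarInner D.tau D.ip ζ (D.oneParam lam (-Complex.I) ξ) := by
  classical
  let s := DFinsupp.support ξ ∪ DFinsupp.support ζ
  have hξ : ∀ t ∉ s, ξ t = 0 := fun t ht =>
    DFinsupp.notMem_support_iff.1 fun h => ht (Finset.mem_union_left _ h)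
  have hζ : ∀ t ∉ s, ζ t = 0 := fun t ht =>
    DFinsupp.notMem_support_iff.1 fun h => ht (Finset.mem_union_right _ h)
  have hSξ : ∀ u ∉ s.image Triple.bar, D.invol lam ξ u = 0 :=
    Triple.bar_involutive.surjective.forall.2 fun t ht => by
      rw [invol_apply_bar, hξ t fun h => ht (Finset.mem_image_of_mem _ h), map_zero, smul_zero]
  rw [D.scalarInner_eq_sum _ hSξ, D.scalarInner_eq_sum _ hζ,
    Finset.sum_image Triple.bar_involutive.injective.injOn]
  refine Finset.sum_congr rfl fun t _ => ?_
  have hsqrt := Real.mul_self_sqrt (letterScalar_pos hlam t.2.2).le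
  calc
    D.dim t.2.1 * D.homInner (D.invol lam ξ (Triple.bar t)) (D.invol lam ζ (Triple.bar t)) =
        letterScalar lam t.2.2 *
          (D.dim t.2.1 * D.homInner (D.homConjHom t (ξ t)) (D.homConjHom t (ζ t))) := by
      rw [invol_apply_bar, invol_apply_bar, homInner_smul_left, homInner_smul_right,
        Complex.star_def, Complex.conj_ofReal, ← mul_assoc ((Real.sqrt _ : ℝ) : ℂ),
        ← Complex.ofReal_mul, hsqrt, mul_left_comm]
    _ = letterScalar lam t.2.2 * (D.dim t.1 * D.homInner (ζ t) (ξ t)) := by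
      rw [dim_mul_homInner_homConjHom]
    _ = D.dim t.1 * D.homInner (ζ t) (D.oneParam lam (-Complex.I) ξ t) := by
      rw [oneParam_apply, homInner_smul_right, mul_neg, Complex.I_mul_I, neg_neg,
        Complex.cpow_one, mul_left_comm]

end Invol

end StandardConjugates

end TomitaFromCategory

end

theorem mainTheorem12 {C : Type u} [Category.{v} C] [Preadditive C] [Linear ℂ C]
    [MonoidalCategory C] [MonoidalPreadditive C] [MonoidalLinear ℂ C]
    [RigidCStarTensorCategory C]
    (hunit : TomitaFromCategory.IsSimpleObj (𝟙_ C))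
    (R : TomitaFromCategory.Representatives C)
    (D : TomitaFromCategory.StandardConjugates R)
    (lam : R.Idx → ℝ) (hlam : ∀ a, 0 < lam a) :
    TomitaBimodule.IsTomitaBimodule (A := TomitaFromCategory.Alg R) (H := D.Hbim)
      D.tau D.ip (D.invol lam) (fun z => D.oneParam lam z) where
  vonNeumann := inferInstance
  trace := TomitaBimodule.isNSFTrace_weightedSum D.dim_pos
  preHilbert := D.isPreHilbertBimodule
  normal := D.hasNormalLeftAction
  finite := D.tau_ip_self_lt_top
  S_add := map_add _
  S_smul := D.invol_smul
  S_action := D.invol_action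
  S_S := D.invol_invol hlam
  U_add _ := map_add _
  U_smul _ := map_smul _
  U_action := D.oneParam_action
  U_bijective := D.oneParam_bijective hlam
  U_zero := D.oneParam_zero
  U_group := D.oneParam_add hlam
  U_continuous := D.tendsto_moduleNorm_oneParam_sub hlam
  U_entire := D.differentiable_scalarInner_oneParam hlam
  S_U := D.invol_oneParam hlam
  U_adjoint := D.scalarInner_oneParam hlam
  S_inner := D.scalarInner_invol hlam
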